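/- Let $F'/F$ be a (possibly infinite) Galois extension of fields with Galois group $\Gamma_{F'/F}$, and let $\Lambda_{F'/F}$ be the set of finite Galois extensions of $F$ in $F'$. A $\Gamma$-category ($\Gamma$ a group) is a category with endofunctors ${}^\sigma(-)$ ($\sigma\in\Gamma$), an isomorphism $u:{}^e(-)\cong\mathrm{id}$ and natural isomorphisms $\mu_{\sigma,\tau}:{}^\sigma({}^\tau(-))\cong{}^{\sigma\tau}(-)$ satisfying the usual associativity and unit conditions. A semilinear abelian $\Gamma_{L/F}$-category is an $L$-linear abelian category with the structure of a $\Gamma_{L/F}$-category such that the ${}^\sigma(-)$ are additive and ${}^\sigma(cf)=\sigma(c)\,{}^\sigma f$ for $c\in L$. A descent system in a $\Gamma$-category $\mathcal C$ is an object $X$ with isomorphisms $\varphi_\sigma:{}^\sigma X\cong X$ such that $\varphi_{\sigma\tau}\circ\mu_{\sigma,\tau,X}=\varphi_\sigma\circ{}^\sigma\varphi_\tau$. Descent systems form a category $\mathrm{DS}(\mathcal C)$, whose morphisms are the morphisms of $\mathcal C$ commuting with the $\varphi_\sigma$. A Borel–Tits datum on a semilinear abelian $\Gamma_{F'/F}$-category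 $\mathcal C$ consists of a full subcategory $\mathrm{DD}(\mathcal C)\subset\mathrm{DS}(\mathcal C)$ that is abelian, a semilinear abelian $\Gamma_{K/F}$-category $\mathcal C_K$ for each $K\in\Lambda_{F'/F}$, a $K$-linear functor $F'\otimes_K(-):\mathcal C_K\to\mathcal C$ for each $K$ and a $K'$-linear functor $K\otimes_{K'}(-):\mathcal C_{K'}\to\mathcal C_K$ for each $K'\subset K$, natural isomorphisms $\alpha_\sigma:{}^\sigma(F'\otimes_K(-))\cong F'\otimes_K{}^{\sigma|_K}(-)$ for $\sigma\in\Gamma_{F'/F}$ and ${}^\sigma(K\otimes_{K'}(-))\cong K\otimes_{K'}{}^{\sigma|_{K'}}(-)$ for $\sigma\in\Gamma_{K/F}$, associative in $\sigma$, and natural isomorphisms $K_2\otimes_{K_3}(K_3\otimes_{K_4}(-))\cong K_2\otimes_{K_4}(-)$ for $K_4\subset K_3\subset K_2$ with $K_3,K_4\in\Lambda_{F'/F}$ and $K_2\in\Lambda_{F'/F}\cup\{F'\}$, satisfying the associativity condition for four fields, such that: $\mathrm{DD}(\mathcal C)$ is closed under isomorphisms in $\mathrm{DS}(\mathcal C)$;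 for all $K\in\Lambda_{F'/F}$ the functor $F'\otimes_K(-)$ is exact, the canonical maps $F'\otimes_K\mathrm{Hom}(X,Y)\to\mathrm{Hom}(F'\otimes_KX,F'\otimes_KY)$ are isomorphisms, and the functor $\mathrm{DS}(\mathcal C_K)\to\mathrm{DS}(\mathcal C)$, $(X,\varphi)\mapsto(F'\otimes_KX,((F'\otimes_K\varphi_{\sigma|_K})\circ\alpha_{\sigma,X})_\sigma)$, takes values in $\mathrm{DD}(\mathcal C)$ and is essentially surjective onto it; and every object $X$ of $\mathcal C$ has, for some $K\in\Lambda_{F'/F}$, a $K$-form, i.e. an object $X_K$ of $\mathcal C_K$ with $F'\otimes_KX_K\cong X$. Fix a Borel–Tits datum on $\mathcal C$ and a nonzero object $M$ of $\mathcal C$ with $\mathrm{End}_{\mathcal C}(M)=F'\,\mathrm{id}_M$. Put $\Gamma_M=\{\sigma\in\Gamma_{F'/F}:{}^\sigma M\cong M\}$ and $F(M)=(F')^{\Gamma_M}$. For a $K$-form $M_K$ of $M$, let $\mathrm{Res}\,M_K$ be the product $\prod_{\tau\in\Gamma_{K/F(M)}}{}^\tau M_K$ with its descent system for $\Gamma_{K/F(M)}$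 that permutes the factors (via $\mu$), and let $\beta_{M_K}\in H^2(\Gamma_{K/F(M)},K^\times)$ be the inverse of the class that corresponds, in Serre's convention, to the algebra $A$ of endomorphisms of this descent system, a central simple $F(M)$-algebra split by $K$: for an isomorphism $\psi:K\otimes_{F(M)}A\cong M_n(K)$ and $P_\sigma\in GL_n(K)$ with $\psi\circ(\sigma\otimes1)\circ\psi^{-1}\circ\sigma^{-1}=\mathrm{Ad}(P_\sigma)$, that class is represented by $P_\sigma\,\sigma(P_\tau)\,P_{\sigma\tau}^{-1}$. Let $\beta^{\mathrm{BT}}_M$ be the image of $\beta_{M_K}$ in the continuous cohomology group $H^2(\Gamma_M,(F')^\times)$. Then: 1. The class $\beta^{\mathrm{BT}}_M\in H^2(\Gamma_M,(F')^\times)$ is well defined: it exists for every $K\in\Lambda_{F'/F}$ and every $K$-form $M_K$ of $M$, and it is independent of the choice of $K$ and $M_K$. 2. There is an object of $\mathrm{DD}(\mathcal C)$ with underlying object $M$ if and only if ${}^\sigma M\cong M$ for all $\sigma\in\Gamma_{F'/F}$ (so that $\Gamma_M=\Gamma_{F'/F}$) and $\beta^{\mathrm{BT}}_M$ is trivial in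 $H^2(\Gamma_{F'/F},(F')^\times)$. -/

import Mathlib

open CategoryTheory Limits TensorProduct

universe w w' u v u' v'

noncomputable section

namespace BorelTits

/-! ### Degree two continuous cohomology with discrete coefficients -/

section Cohomology

variable (G : Type*) [Group G] [TopologicalSpace G]
variable (A : Type*) [CommGroup A] [MulDistribMulAction G A]

/-- Continuous (i.e. locally constant) inhomogeneous 2-cocycles of `G` with values in the discrete
`G`-module `A`: `f (gh, j) * f (g, h) = g • f (h, j) * f (g, hj)`. -/
def contCocycles₂ : Subgroup (G × G → A) where
  carrier := {f | groupCohomology.IsMulCocycle₂ f ∧ IsLocallyConstant f}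
  one_mem' := ⟨fun g h j => by simp, IsLocallyConstant.const 1⟩
  mul_mem' := by
    rintro f f' ⟨hf, hf₁⟩ ⟨hf', hf₁'⟩
    refine ⟨fun g h j => ?_, hf₁.mul hf₁'⟩
    have h1 := hf g h j
    have h2 := hf' g h j
    simp only [Pi.mul_apply, smul_mul']
    rw [mul_mul_mul_comm, h1, h2, mul_mul_mul_comm]
  inv_mem' := by
    rintro f ⟨hf, hf₁⟩
    refine ⟨fun g h j => ?_, hf₁.inv⟩
    have h1 := hf g h j
    simp only [Pi.inv_apply, smul_inv']
    rw [← mul_inv, h1, mul_inv]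

/-- Coboundaries `(g, h) ↦ g • x h / x (gh) * x g` of continuous 1-cochains. -/
def contCoboundaries₂ : Subgroup (G × G → A) where
  carrier := {f | ∃ x : G → A, IsLocallyConstant x ∧
    ∀ g h : G, g • x h / x (g * h) * x g = f (g, h)}
  one_mem' := ⟨1, IsLocallyConstant.const 1, fun g h => by simp⟩
  mul_mem' := by
    rintro f f' ⟨x, hx, hf⟩ ⟨x', hx', hf'⟩
    refine ⟨x * x', hx.mul hx', fun g h => ?_⟩
    simp only [Pi.mul_apply, smul_mul', ← hf, ← hf', div_eq_mul_inv, mul_inv]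
    ac_rfl
  inv_mem' := by
    rintro f ⟨x, hx, hf⟩
    refine ⟨x⁻¹, hx.inv, fun g h => ?_⟩
    simp only [Pi.inv_apply, smul_inv', ← hf, div_eq_mul_inv, mul_inv]

/-- `H²(G, A)`, the second continuous cohomology group. -/
abbrev H2 : Type _ := contCocycles₂ G A ⧸ (contCoboundaries₂ G A).subgroupOf (contCocycles₂ G A)

variable {G A}

/-- The cohomology class of a 2-cocycle. -/
def H2.mk (f : contCocycles₂ G A) : H2 G A := QuotientGroup.mk f

variable {G' : Type*} [Group G'] [TopologicalSpace G']
variable {A' : Type*} [CommGroup A'] [MulDistribMulAction G' A']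

/-- Pull-back of cocycles along a compatible pair `φ : G → G'`, `ι : A' → A`. -/
def contCocycles₂.map (φ : G →* G') (hφ : Continuous φ) (ι : A' →* A)
    (hι : ∀ (g : G) (a : A'), ι (φ g • a) = g • ι a) :
    contCocycles₂ G' A' →* contCocycles₂ G A where
  toFun f := ⟨fun p => ι (f.1 (φ p.1, φ p.2)), fun g h j => by
      have := congrArg ι (f.2.1 (φ g) (φ h) (φ j))
      simpa only [map_mul, hι] using this,
    (f.2.2.comp_continuous (hφ.prodMap hφ)).comp ι⟩
  map_one' := by ext p; simp
  map_mul' f f' := by ext p; simp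

/-- The map `H²(G', A') → H²(G, A)` induced by a compatible pair `φ : G → G'`, `ι : A' → A`. -/
def H2.map (φ : G →* G') (hφ : Continuous φ) (ι : A' →* A)
    (hι : ∀ (g : G) (a : A'), ι (φ g • a) = g • ι a) : H2 G' A' →* H2 G A :=
  QuotientGroup.map _ _ (contCocycles₂.map φ hφ ι hι) (by
    rintro f hf
    obtain ⟨x, hx, hfx⟩ := Subgroup.mem_subgroupOf.1 hf
    refine Subgroup.mem_comap.2 (Subgroup.mem_subgroupOf.2
      ⟨fun g => ι (x (φ g)), (hx.comp_continuous hφ).comp ι, fun g h => ?_⟩)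
    have := congrArg ι (hfx (φ g) (φ h))
    simp only [map_mul, map_div, hι] at this ⊢
    exact this)

end Cohomology

attribute [local instance] Units.mulDistribMulActionRight

/-- `H²(G, Lˣ)` for a group `G` acting on a field `L`. -/
abbrev H2Units (G : Type*) [Group G] [TopologicalSpace G] (L : Type*) [Field L]
    [MulSemiringAction G L] : Type _ := H2 G Lˣ

/-! ### The cohomology class of a split central simple algebra -/

/-- Let a finite group `G` act faithfully on the field `L`, so that `L` is a Galois extension of
the fixed field `k` with group `G`, and let `A` be a `k`-algebra. `IsBrauerClass G L A c` says that
`A` is a central simple `k`-algebra split by `L`, and that `c` corresponds to it under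
the bijection `Br(L/k) ≅ H²(G, Lˣ)` in Serre's convention: for an isomorphism
`ψ : L ⊗[k] A ≅ M_n(L)` with `n ≥ 1`, the automorphism `ψ ∘ (σ ⊗ 1) ∘ ψ⁻¹ ∘ σ⁻¹` of `M_n(L)` is
conjugation by a matrix `P σ`, and `c` is the class of the cocycle
`(σ, τ) ↦ P σ * σ (P τ) * (P (σ τ))⁻¹`. -/
def IsBrauerClass (G : Type*) [Group G] [TopologicalSpace G] (L : Type*) [Field L]
    [MulSemiringAction G L] (A : Type*) [Ring A] [Algebra (FixedPoints.subfield G L) A]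
    (c : H2Units G L) : Prop :=
  ∃ (n : ℕ) (_ : 0 < n)
    (ψ : (L ⊗[FixedPoints.subfield G L] A) ≃ₐ[L] Matrix (Fin n) (Fin n) L)
    (P : G → GL (Fin n) L) (f : contCocycles₂ G Lˣ),
    (∀ (σ : G) (a : L) (x : A), ψ ((σ • a) ⊗ₜ x) =
      (P σ : Matrix (Fin n) (Fin n) L) * (ψ (a ⊗ₜ x)).map (fun y => σ • y) *
        ((P σ)⁻¹ : GL (Fin n) L)) ∧
    (∀ σ τ : G, (P σ : Matrix (Fin n) (Fin n) L) *
      (P τ : Matrix (Fin n) (Fin n) L).map (fun y => σ • y) =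
        ((f.1 (σ, τ) : Lˣ) : L) • (P (σ * τ) : Matrix (Fin n) (Fin n) L)) ∧
    c = H2.mk f

/-! ### `Γ`-categories and descent systems -/

/-- A `Γ`-category. The isomorphism `μ_{σ,τ} : ^σ(-) ∘ ^τ(-) ≅ ^{στ}(-)` is written
`mu h : twist τ ⋙ twist σ ≅ twist ρ` for `h : σ * τ = ρ`; naming the product by `ρ` avoids
transporting along equalities such as `(σ * τ) * ρ = σ * (τ * ρ)`. -/
class GammaCategory (Γ : Type w) [Group Γ] (C : Type u) [Category.{v} C] where
  /-- The endofunctor `^σ(-)`. -/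
  twist : Γ → C ⥤ C
  /-- `u : ^e(-) ≅ id`. -/
  unit : twist 1 ≅ 𝟭 C
  /-- `μ_{σ,τ}`. -/
  mu : ∀ {σ τ ρ : Γ}, σ * τ = ρ → (twist τ ⋙ twist σ ≅ twist ρ)
  assoc : ∀ {σ τ ρ στ τρ στρ : Γ} (h₁ : σ * τ = στ) (h₂ : τ * ρ = τρ) (h₃ : σ * τρ = στρ)
    (h₄ : στ * ρ = στρ) (X : C),
    (twist σ).map ((mu h₂).hom.app X) ≫ (mu h₃).hom.app X =
      (mu h₁).hom.app ((twist ρ).obj X) ≫ (mu h₄).hom.app X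
  mu_one_left : ∀ (σ : Γ) (X : C),
    (mu (one_mul σ)).hom.app X = unit.hom.app ((twist σ).obj X)
  mu_one_right : ∀ (σ : Γ) (X : C),
    (mu (mul_one σ)).hom.app X = (twist σ).map (unit.hom.app X)

open GammaCategory

section GammaCategories

variable {Γ : Type w} [Group Γ] {C : Type u} [Category.{v} C] [GammaCategory Γ C]

/-- Restriction of a `Γ`-category structure to a subgroup. -/
instance GammaCategory.restrict (H : Subgroup Γ) : GammaCategory H C where
  twist σ := twist (σ : Γ)
  unit := unit (Γ := Γ)
  mu h := mu (congrArg Subtype.val h)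
  assoc h₁ h₂ h₃ h₄ X := assoc (congrArg Subtype.val h₁) (congrArg Subtype.val h₂)
    (congrArg Subtype.val h₃) (congrArg Subtype.val h₄) X
  mu_one_left σ X := mu_one_left (σ : Γ) X
  mu_one_right σ X := mu_one_right (σ : Γ) X

variable (Γ) in
/-- `X` is self-conjugate if `^σ X ≅ X` for all `σ`. -/
def IsSelfConjugate (X : C) : Prop := ∀ σ : Γ, Nonempty ((twist σ).obj X ≅ X)

variable (Γ) in
/-- `Γ_X = {σ | ^σ X ≅ X}`. -/
def stabilizer (X : C) : Subgroup Γ where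
  carrier := {σ | Nonempty ((twist σ).obj X ≅ X)}
  one_mem' := ⟨unit.app X⟩
  mul_mem' := by
    rintro σ τ ⟨a⟩ ⟨b⟩
    exact ⟨((mu rfl).app X).symm ≪≫ (twist σ).mapIso b ≪≫ a⟩
  inv_mem' := by
    rintro σ ⟨a⟩
    exact ⟨(twist σ⁻¹).mapIso a.symm ≪≫ (mu (inv_mul_cancel σ)).app X ≪≫ unit.app X⟩

end GammaCategories

/-- The twists of a preadditive `Γ`-category are additive. -/
class IsAdditive (Γ : Type w) [Group Γ] (C : Type u) [Category.{v} C] [Preadditive C]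
    [GammaCategory Γ C] : Prop where
  additive : ∀ σ : Γ, (twist σ : C ⥤ C).Additive

attribute [instance] IsAdditive.additive

/-- A `Γ`-category which is linear over `L`, where `Γ` acts on the field `L`, is semilinear if
`^σ (c f) = σ(c) ^σ f`. -/
class IsSemilinear (Γ : Type w) [Group Γ] (L : Type w') [Field L] [MulSemiringAction Γ L]
    (C : Type u) [Category.{v} C] [Preadditive C] [Linear L C] [GammaCategory Γ C] : Prop where
  map_smul : ∀ (σ : Γ) (c : L) {X Y : C} (f : X ⟶ Y),
    (twist σ).map (c • f) = (σ • c) • (twist σ).map f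

/-- Restriction of additivity to a subgroup. -/
instance IsAdditive.restrict {Γ : Type w} [Group Γ] {C : Type u} [Category.{v} C] [Preadditive C]
    [GammaCategory Γ C] [IsAdditive Γ C] (H : Subgroup Γ) : IsAdditive H C where
  additive σ := IsAdditive.additive (σ : Γ)

/-- Restriction of semilinearity to a subgroup. -/
instance IsSemilinear.restrict {Γ : Type w} [Group Γ] {L : Type w'} [Field L]
    [MulSemiringAction Γ L] {C : Type u} [Category.{v} C] [Preadditive C] [Linear L C]
    [GammaCategory Γ C] [IsSemilinear Γ L C] (H : Subgroup Γ) : IsSemilinear H L C where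
  map_smul σ c _ _ f := IsSemilinear.map_smul (σ : Γ) c f

/-- A descent system: an object with isomorphisms `φ σ : ^σ X ≅ X` such that
`φ (στ) ∘ μ_{σ,τ} = φ σ ∘ ^σ (φ τ)`. -/
structure DescentSystem (Γ : Type w) [Group Γ] (C : Type u) [Category.{v} C]
    [GammaCategory Γ C] where
  /-- The underlying object. -/
  obj : C
  /-- The isomorphisms `^σ X ≅ X`. -/
  φ : ∀ σ : Γ, (twist σ).obj obj ≅ obj
  cond : ∀ σ τ : Γ, (mu (rfl : σ * τ = σ * τ)).hom.app obj ≫ (φ (σ * τ)).hom =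
    (twist σ).map (φ τ).hom ≫ (φ σ).hom

namespace DescentSystem

variable {Γ : Type w} [Group Γ] {C : Type u} [Category.{v} C] [GammaCategory Γ C]

/-- Morphisms of descent systems. -/
@[ext]
structure Hom (X Y : DescentSystem Γ C) where
  /-- The underlying morphism. -/
  hom : X.obj ⟶ Y.obj
  comm : ∀ σ : Γ, (X.φ σ).hom ≫ hom = (twist σ).map hom ≫ (Y.φ σ).hom

/-- The category `DS(C)` of descent systems. -/
instance : Category (DescentSystem Γ C) where
  Hom := Hom
  id X := ⟨𝟙 _, fun σ => by simp⟩
  comp f g := ⟨f.hom ≫ g.hom, fun σ => by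
    rw [← Category.assoc, f.comm, Category.assoc, g.comm, Functor.map_comp, Category.assoc]⟩
  id_comp f := Hom.ext (Category.id_comp _)
  comp_id f := Hom.ext (Category.comp_id _)
  assoc f g h := Hom.ext (Category.assoc _ _ _)

@[ext]
lemma hom_ext {X Y : DescentSystem Γ C} {f g : X ⟶ Y} (h : f.hom = g.hom) : f = g := Hom.ext h

@[simp] lemma id_hom (X : DescentSystem Γ C) : (𝟙 X : X ⟶ X).hom = 𝟙 X.obj := rfl

@[simp] lemma comp_hom {X Y Z : DescentSystem Γ C} (f : X ⟶ Y) (g : Y ⟶ Z) :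
    (f ≫ g).hom = f.hom ≫ g.hom := rfl

section Linear

variable [Preadditive C] [IsAdditive Γ C]

/-- The morphisms of descent systems, as an additive subgroup of the morphisms of `C`. -/
def homAddSubgroup (X Y : DescentSystem Γ C) : AddSubgroup (X.obj ⟶ Y.obj) where
  carrier := {f | ∀ σ : Γ, (X.φ σ).hom ≫ f = (twist σ).map f ≫ (Y.φ σ).hom}
  zero_mem' σ := by simp
  add_mem' {f g} hf hg σ := by
    rw [Preadditive.comp_add, hf σ, hg σ, Functor.map_add, Preadditive.add_comp]
  neg_mem' {f} hf σ := by
    rw [Preadditive.comp_neg, hf σ, Functor.map_neg, Preadditive.neg_comp]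

/-- Morphisms of descent systems are the elements of `homAddSubgroup`. -/
def homEquiv (X Y : DescentSystem Γ C) : (X ⟶ Y) ≃ homAddSubgroup X Y where
  toFun f := ⟨f.hom, f.comm⟩
  invFun f := ⟨f.1, f.2⟩

/-- Morphisms of descent systems are added in `C`. -/
instance : Preadditive (DescentSystem Γ C) where
  homGroup X Y := (homEquiv X Y).addCommGroup
  add_comp _ _ _ f f' g := hom_ext (Preadditive.add_comp _ _ _ f.hom f'.hom g.hom)
  comp_add _ _ _ f g g' := hom_ext (Preadditive.comp_add _ _ _ f.hom g.hom g'.hom)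

@[simp] lemma add_hom {X Y : DescentSystem Γ C} (f g : X ⟶ Y) :
    (f + g).hom = f.hom + g.hom := rfl

@[simp] lemma zero_hom (X Y : DescentSystem Γ C) : (0 : X ⟶ Y).hom = 0 := rfl

variable (L : Type w') [Field L] [MulSemiringAction Γ L] [Linear L C] [IsSemilinear Γ L C]

/-- In the semilinear case `DS(C)` is linear over the fixed field `L^Γ`. -/
instance : Linear (FixedPoints.subfield Γ L) (DescentSystem Γ C) where
  homModule X Y :=
    { smul := fun c f => ⟨(c : L) • f.hom, fun σ => by
        rw [Linear.comp_smul, f.comm, IsSemilinear.map_smul, Linear.smul_comp, c.2 σ]⟩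
      one_smul := fun f => hom_ext (one_smul L f.hom)
      mul_smul := fun c d f => hom_ext (mul_smul (c : L) (d : L) f.hom)
      smul_zero := fun c => hom_ext (smul_zero (c : L))
      smul_add := fun c f g => hom_ext (smul_add (c : L) f.hom g.hom)
      add_smul := fun c d f => hom_ext (add_smul (c : L) (d : L) f.hom)
      zero_smul := fun f => hom_ext (zero_smul L f.hom) }
  smul_comp _ _ _ c f g := hom_ext (Linear.smul_comp _ _ _ (c : L) f.hom g.hom)
  comp_smul _ _ _ f c g := hom_ext (Linear.comp_smul _ _ _ f.hom (c : L) g.hom)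

end Linear

/-- A family of morphisms satisfying the condition of a descent system and equal to `u` at the
unit consists of isomorphisms. -/
def ofHom (X : C) (ψ : ∀ σ : Γ, (twist σ).obj X ⟶ X)
    (h1 : ψ 1 = unit.hom.app X)
    (hψ : ∀ {σ τ ρ : Γ} (h : σ * τ = ρ), (mu h).hom.app X ≫ ψ ρ = (twist σ).map (ψ τ) ≫ ψ σ) :
    DescentSystem Γ C :=
  have key : ∀ σ τ : Γ, σ * τ = 1 → IsIso ((twist σ).map (ψ τ) ≫ ψ σ) := fun σ τ h => by
    rw [← hψ h, h1]; infer_instance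
  have iso : ∀ σ : Γ, IsIso (ψ σ) := fun σ => by
    have h₁ := key σ σ⁻¹ (mul_inv_cancel σ)
    have h₂ := key σ⁻¹ σ (inv_mul_cancel σ)
    have hs : IsSplitEpi (ψ σ) :=
      ⟨⟨⟨inv ((twist σ).map (ψ σ⁻¹) ≫ ψ σ) ≫ (twist σ).map (ψ σ⁻¹), by simp⟩⟩⟩
    have hi : IsIso ((twist σ⁻¹).map (ψ σ)) := by
      have : Mono ((twist σ⁻¹).map (ψ σ)) := mono_of_mono _ (ψ σ⁻¹)
      exact isIso_of_mono_of_isSplitEpi _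
    have hj : IsIso ((twist σ).map ((twist σ⁻¹).map (ψ σ))) := inferInstance
    have nat := (mu (mul_inv_cancel σ)).hom.naturality (ψ σ)
    have nat' := (unit (Γ := Γ) (C := C)).hom.naturality (ψ σ)
    simp only [Functor.comp_map, Functor.id_map] at nat nat'
    have : IsIso ((twist (1 : Γ)).map (ψ σ)) := by
      rw [← IsIso.inv_comp_eq] at nat
      rw [← nat]
      infer_instance
    rw [← IsIso.inv_comp_eq] at nat'
    rw [← nat']
    infer_instance
  { obj := X
    φ := fun σ => haveI := iso σ; asIso (ψ σ)
    cond := fun _ _ => hψ rfl }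

/-- For finite `Γ`, the descent system `Res N` on the product `∏ ^τ N` over `τ ∈ Γ`: the structure
morphism `^σ (∏ ^τ N) ⟶ ∏ ^τ N` permutes the factors, its component at `τ` being the projection to
`^σ (^{σ⁻¹τ} N)` followed by `μ`. It is the value at `N` of the right adjoint of the forgetful
functor `DS(C) ⥤ C`. -/
def res [HasFiniteProducts C] (Γ : Type w) [Group Γ] [Finite Γ] [GammaCategory Γ C] (N : C) :
    DescentSystem Γ C :=
  ofHom (∏ᶜ fun τ : Γ => (twist τ).obj N)
    (fun σ => Pi.lift fun τ =>
      (twist σ).map (Pi.π (fun τ : Γ => (twist τ).obj N) (σ⁻¹ * τ)) ≫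
        (mu (mul_inv_cancel_left σ τ)).hom.app N)
    (by
      refine Limits.Pi.hom_ext _ _ fun τ => ?_
      have aux : ∀ (τ' : Γ) (h : 1 * τ' = τ),
          (twist 1).map (Pi.π (fun τ : Γ => (twist τ).obj N) τ') ≫ (mu h).hom.app N =
            unit.hom.app _ ≫ Pi.π (fun τ : Γ => (twist τ).obj N) τ := by
        intro τ' h
        obtain rfl : τ' = τ := by simpa using h
        rw [mu_one_left]
        exact unit.hom.naturality _
      simpa using aux _ _)
    (by
      intro σ τ ρ h
      refine Limits.Pi.hom_ext _ _ fun t => ?_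
      have aux : ∀ (a b c : Γ) (h₁ : ρ * a = t) (h₂ : τ * b = c) (h₃ : σ * c = t),
          (mu h).hom.app _ ≫ (twist ρ).map (Pi.π (fun τ : Γ => (twist τ).obj N) a) ≫
              (mu h₁).hom.app N =
            (twist σ).map ((twist τ).map (Pi.π (fun τ : Γ => (twist τ).obj N) b) ≫
              (mu h₂).hom.app N) ≫ (mu h₃).hom.app N := by
        intro a b c h₁ h₂ h₃
        obtain rfl : b = a := by
          rw [← h, mul_assoc, ← h₃, ← h₂] at h₁
          exact (mul_left_cancel (mul_left_cancel h₁)).symm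
        rw [Functor.map_comp, Category.assoc, assoc h h₂ h₃ h₁, ← Category.assoc,
          ← Category.assoc]
        congr 1
        exact ((mu h).hom.naturality _).symm
      have := aux _ _ _ (mul_inv_cancel_left ρ t) (mul_inv_cancel_left τ (σ⁻¹ * t))
        (mul_inv_cancel_left σ t)
      simp only [Category.assoc, Limits.Pi.lift_π]
      rw [this, ← Functor.map_comp_assoc, Limits.Pi.lift_π])

end DescentSystem

/-- The Borel--Tits class over a finite Galois extension. Let the finite group `G` act faithfully
on `L`, let `C` be a semilinear abelian `G`-category, and let `N` be a self-conjugate object of `C`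
with only scalar endomorphisms. The class `b` of `N` in `H²(G, Lˣ)` is the inverse of the one that
corresponds to the central simple algebra `End_{DS(C)}(Res N)` over the fixed field `L^G`. -/
def IsFiniteBorelTitsClass (G : Type w) [Group G] [TopologicalSpace G] [Finite G]
    (L : Type w') [Field L] [MulSemiringAction G L] {C : Type u} [Category.{v} C] [Abelian C]
    [Linear L C] [GammaCategory G C] [IsAdditive G C] [IsSemilinear G L C] (N : C)
    (b : H2Units G L) : Prop :=
  IsBrauerClass G L (End (DescentSystem.res G N)) b⁻¹

/-! ### Base change functors -/

/-- Compatibility of a functor `T : C ⥤ D` from a `Γ'`-category to a `Γ`-category with the twists,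
along a homomorphism `r : Γ → Γ'`: isomorphisms `α_σ : ^σ (T -) ≅ T (^{r σ} -)`, associative
in `σ`. -/
structure TwistCompat {Γ : Type w} [Group Γ] {Γ' : Type w'} [Group Γ'] (r : Γ →* Γ')
    {C : Type u} [Category.{v} C] [GammaCategory Γ' C]
    {D : Type u'} [Category.{v'} D] [GammaCategory Γ D] (T : C ⥤ D) where
  /-- `α_σ`. -/
  α : ∀ σ : Γ, T ⋙ twist σ ≅ twist (r σ) ⋙ T
  assoc : ∀ (σ τ : Γ) (X : C),
    (mu (rfl : σ * τ = σ * τ)).hom.app (T.obj X) ≫ (α (σ * τ)).hom.app X =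
      (twist σ).map ((α τ).hom.app X) ≫ (α σ).hom.app ((twist (r τ)).obj X) ≫
        T.map ((mu (map_mul r σ τ).symm).hom.app X)

/-- The functor `DS(C) ⥤ DS(D)` induced by a functor `C ⥤ D` compatible with twists: it sends
`(X, φ)` to `T X` with the isomorphisms `T (φ (r σ)) ∘ α_σ`. -/
def TwistCompat.mapDS {Γ : Type w} [Group Γ] {Γ' : Type w'} [Group Γ'] {r : Γ →* Γ'}
    {C : Type u} [Category.{v} C] [GammaCategory Γ' C]
    {D : Type u'} [Category.{v'} D] [GammaCategory Γ D] {T : C ⥤ D} (a : TwistCompat r T) :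
    DescentSystem Γ' C ⥤ DescentSystem Γ D where
  obj X :=
    { obj := T.obj X.obj
      φ := fun σ => (a.α σ).app X.obj ≪≫ T.mapIso (X.φ (r σ))
      cond := fun σ τ => by
        have key : ∀ (ρ : Γ') (h : r σ * r τ = ρ), (mu h).hom.app X.obj ≫ (X.φ ρ).hom =
            (twist (r σ)).map (X.φ (r τ)).hom ≫ (X.φ (r σ)).hom := by
          rintro _ rfl
          exact X.cond _ _
        have nat := (a.α σ).hom.naturality (X.φ (r τ)).hom
        simp only [Functor.comp_map] at nat
        simp only [Iso.trans_hom, Iso.app_hom, Functor.mapIso_hom, Functor.map_comp,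
          Category.assoc]
        rw [← Category.assoc, a.assoc, reassoc_of% nat]
        simp only [Category.assoc, ← Functor.map_comp]
        rw [key] }
  map {X Y} f :=
    { hom := T.map f.hom
      comm := fun σ => by
        have nat := (a.α σ).hom.naturality f.hom
        simp only [Functor.comp_map] at nat
        simp only [Iso.trans_hom, Iso.app_hom, Functor.mapIso_hom, Category.assoc]
        rw [reassoc_of% nat, ← Functor.map_comp, f.comm, Functor.map_comp] }
  map_id X := DescentSystem.hom_ext (T.map_id _)
  map_comp f g := DescentSystem.hom_ext (T.map_comp _ _)

/-- A functor from a `K`-linear category to an `L`-linear category is `K`-linear, `K → L` being a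
homomorphism of fields. -/
class IsLinearAlong {K : Type w} [Field K] {L : Type w'} [Field L] (i : K →+* L)
    {C : Type u} [Category.{v} C] [Preadditive C] [Linear K C]
    {D : Type u'} [Category.{v'} D] [Preadditive D] [Linear L D] (T : C ⥤ D) : Prop where
  map_add : ∀ {X Y : C} (f g : X ⟶ Y), T.map (f + g) = T.map f + T.map g
  map_smul : ∀ {X Y : C} (c : K) (f : X ⟶ Y), T.map (c • f) = i c • T.map f

/-- The canonical map `L ⊗[K] Hom(X, Y) → Hom(T X, T Y)`, `c ⊗ f ↦ c • T f`, for a `K`-linear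
functor `T` to an `L`-linear category. -/
def baseChangeMap (K : Type w) [Field K] (L : Type w') [Field L] [Algebra K L]
    {C : Type u} [Category.{v} C] [Preadditive C] [Linear K C]
    {D : Type u'} [Category.{v'} D] [Preadditive D] [Linear L D]
    (T : C ⥤ D) [IsLinearAlong (algebraMap K L) T] (X Y : C) :
    L ⊗[K] (X ⟶ Y) →+ (T.obj X ⟶ T.obj Y) :=
  TensorProduct.liftAddHom
    { toFun := fun c =>
        { toFun := fun f => c • T.map f
          map_zero' := by
            have h := IsLinearAlong.map_smul (i := algebraMap K L) (T := T) 0 (0 : X ⟶ Y)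
            rw [zero_smul, map_zero, zero_smul] at h
            rw [h, smul_zero]
          map_add' := fun f g => by
            rw [IsLinearAlong.map_add (i := algebraMap K L), smul_add] }
      map_zero' := by ext f; exact zero_smul L (T.map f)
      map_add' := fun c d => by ext f; exact add_smul c d (T.map f) }
    (fun k c f => by
      change (k • c) • T.map f = c • T.map (k • f)
      rw [IsLinearAlong.map_smul (i := algebraMap K L), smul_smul, Algebra.smul_def, mul_comm])

@[simp] lemma baseChangeMap_tmul (K : Type w) [Field K] (L : Type w') [Field L] [Algebra K L]
    {C : Type u} [Category.{v} C] [Preadditive C] [Linear K C]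
    {D : Type u'} [Category.{v'} D] [Preadditive D] [Linear L D]
    (T : C ⥤ D) [IsLinearAlong (algebraMap K L) T] (X Y : C) (c : L) (f : X ⟶ Y) :
    baseChangeMap K L T X Y (c ⊗ₜ f) = c • T.map f := rfl

/-! ### Borel--Tits data -/

section Data

variable {F : Type w} [Field F] {F' : Type w'} [Field F'] [Algebra F F']

/-- The restriction `Gal(K/F) → Gal(K'/F)` for `K' ⊆ K` in `Λ_{F'/F}`. -/
def restrictHom {K' K : FiniteGaloisIntermediateField F F'} (h : K' ≤ K) :
    Gal(K/F) →* Gal(K'/F) :=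
  letI : Algebra K' K := (IntermediateField.inclusion h).toRingHom.toAlgebra
  haveI : IsScalarTower F K' K := IsScalarTower.of_algebraMap_eq fun _ => rfl
  AlgEquiv.restrictNormalHom K'

lemma restrictHom_apply {K' K : FiniteGaloisIntermediateField F F'} (h : K' ≤ K) (σ : Gal(K/F))
    (x : K') : ((restrictHom h σ x : K') : F') = σ (IntermediateField.inclusion h x) := by
  let _ : Algebra K' K := (IntermediateField.inclusion h).toRingHom.toAlgebra
  have : IsScalarTower F K' K := IsScalarTower.of_algebraMap_eq fun _ => rfl
  exact congrArg Subtype.val (AlgEquiv.restrictNormal_commutes σ K' x)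

variable (F F') in
/-- A Borel--Tits datum on a semilinear abelian `Gal(F'/F)`-category `C`. The members of
`Λ_{F'/F}`, the finite Galois extensions of `F` in `F'`, are the terms of
`FiniteGaloisIntermediateField F F'`. -/
structure Datum (C : Type u) [Category.{v} C] [Abelian C] [Linear F' C]
    [GammaCategory Gal(F'/F) C] [IsAdditive Gal(F'/F) C] [IsSemilinear Gal(F'/F) F' C] where
  /-- The full subcategory `DD(C)` of `DS(C)`. -/
  DD : ObjectProperty (DescentSystem Gal(F'/F) C)
  abelian_DD : Nonempty (Abelian DD.FullSubcategory)
  /-- The category `C_K`. -/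
  cat : FiniteGaloisIntermediateField F F' → Type u'
  [category : ∀ K, Category.{v'} (cat K)]
  [abelian : ∀ K, Abelian (cat K)]
  [linear : ∀ K : FiniteGaloisIntermediateField F F', Linear K (cat K)]
  [gamma : ∀ K : FiniteGaloisIntermediateField F F', GammaCategory Gal(K/F) (cat K)]
  [isAdditive : ∀ K : FiniteGaloisIntermediateField F F', IsAdditive Gal(K/F) (cat K)]
  [isSemilinear : ∀ K : FiniteGaloisIntermediateField F F', IsSemilinear Gal(K/F) K (cat K)]
  /-- The functor `F' ⊗_K -`. -/
  top : ∀ K : FiniteGaloisIntermediateField F F', cat K ⥤ C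
  [linear_top : ∀ K : FiniteGaloisIntermediateField F F', IsLinearAlong (algebraMap K F') (top K)]
  /-- The functor `K ⊗_{K'} -`. -/
  bc : ∀ {K' K : FiniteGaloisIntermediateField F F'}, K' ≤ K → (cat K' ⥤ cat K)
  linear_bc : ∀ {K' K : FiniteGaloisIntermediateField F F'} (h : K' ≤ K),
    IsLinearAlong (IntermediateField.inclusion h).toRingHom (bc h)
  /-- `α^K_σ`, associative in `σ`. -/
  twistTop : ∀ K : FiniteGaloisIntermediateField F F',
    TwistCompat (AlgEquiv.restrictNormalHom K : Gal(F'/F) →* Gal(K/F)) (top K)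
  /-- `α^{K/K'}_σ`, associative in `σ`. -/
  twistBc : ∀ {K' K : FiniteGaloisIntermediateField F F'} (h : K' ≤ K),
    TwistCompat (restrictHom h) (bc h)
  /-- `γ^{F'/K₃/K₄}`. -/
  γTop : ∀ {K₄ K₃ : FiniteGaloisIntermediateField F F'} (h : K₄ ≤ K₃), bc h ⋙ top K₃ ≅ top K₄
  /-- `γ^{K₂/K₃/K₄}`. -/
  γ : ∀ {K₄ K₃ K₂ : FiniteGaloisIntermediateField F F'} (h : K₄ ≤ K₃) (h' : K₃ ≤ K₂),
    bc h ⋙ bc h' ≅ bc (h.trans h')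
  γTop_natural : ∀ {K₅ K₄ K₃ : FiniteGaloisIntermediateField F F'} (h : K₅ ≤ K₄) (h' : K₄ ≤ K₃)
    (X : cat K₅), (γTop h').hom.app ((bc h).obj X) ≫ (γTop h).hom.app X =
      (top K₃).map ((γ h h').hom.app X) ≫ (γTop (h.trans h')).hom.app X
  γ_natural : ∀ {K₅ K₄ K₃ K₂ : FiniteGaloisIntermediateField F F'} (h : K₅ ≤ K₄) (h' : K₄ ≤ K₃)
    (h'' : K₃ ≤ K₂) (X : cat K₅),
    (γ h' h'').hom.app ((bc h).obj X) ≫ (γ h (h'.trans h'')).hom.app X =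
      (bc h'').map ((γ h h').hom.app X) ≫ (γ (h.trans h') h'').hom.app X
  strict : ∀ {X Y : DescentSystem Gal(F'/F) C}, Nonempty (X ≅ Y) → DD X → DD Y
  exact_left : ∀ K, PreservesFiniteLimits (top K)
  exact_right : ∀ K, PreservesFiniteColimits (top K)
  bijective_baseChangeMap : ∀ (K : FiniteGaloisIntermediateField F F') (X Y : cat K),
    Function.Bijective (baseChangeMap K F' (top K) X Y)
  /-- `DS(C_K) ⥤ DS(C)` takes values in `DD(C)` ... -/
  mapDS_mem : ∀ (K : FiniteGaloisIntermediateField F F') (Y : DescentSystem Gal(K/F) (cat K)),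
    DD ((twistTop K).mapDS.obj Y)
  /-- ... and is essentially surjective onto `DD(C)`. -/
  essSurj : ∀ (K : FiniteGaloisIntermediateField F F') (X : DescentSystem Gal(F'/F) C), DD X →
    ∃ Y : DescentSystem Gal(K/F) (cat K), Nonempty ((twistTop K).mapDS.obj Y ≅ X)
  exists_form : ∀ X : C, ∃ (K : FiniteGaloisIntermediateField F F') (Y : cat K),
    Nonempty ((top K).obj Y ≅ X)

attribute [instance] Datum.category Datum.abelian Datum.linear Datum.gamma Datum.isAdditive
  Datum.isSemilinear Datum.linear_top

section Rationality

variable (F F') {C : Type u} [Category.{v} C] [GammaCategory Gal(F'/F) C]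

/-- The field of rationality `F(M)`: the fixed field of `Γ_M = {σ | ^σ M ≅ M}`. -/
def rationalityField (M : C) : IntermediateField F F' :=
  IntermediateField.fixedField (stabilizer Gal(F'/F) M)

/-- `Γ_{K/F(M)}`, the elements of `Gal(K/F)` that fix the elements of `F(M)` lying in `K`
(if `K` is the field of definition of a form of `M`, then `F(M) ⊆ K`). -/
def relGal (K : FiniteGaloisIntermediateField F F') (M : C) : Subgroup Gal(K/F) :=
  ((rationalityField F F' M).comap K.toIntermediateField.val).fixingSubgroup

/-- The restriction `Γ_M → Γ_{K/F(M)}`. -/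
def stabilizerToRelGal (K : FiniteGaloisIntermediateField F F') (M : C) :
    stabilizer Gal(F'/F) M →* relGal F F' K M :=
  ((AlgEquiv.restrictNormalHom K : Gal(F'/F) →* Gal(K/F)).comp
    (stabilizer Gal(F'/F) M).subtype).codRestrict _ (by
      rintro ⟨σ, hσ⟩
      refine (IntermediateField.mem_fixingSubgroup_iff _ _).2 fun x hx => Subtype.ext ?_
      exact (AlgEquiv.restrictNormalHom_apply K.toIntermediateField σ x).trans (hx ⟨σ, hσ⟩))

lemma continuous_stabilizerToRelGal (K : FiniteGaloisIntermediateField F F') (M : C) :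
    Continuous (stabilizerToRelGal F F' K M) :=
  ((InfiniteGalois.restrictNormalHom_continuous K.toIntermediateField).comp
    continuous_subtype_val).subtype_mk _

/-- The canonical map `H²(Γ_{K/F(M)}, Kˣ) → H²(Γ_M, F'ˣ)`. -/
def inflation (K : FiniteGaloisIntermediateField F F') (M : C) :
    H2Units (relGal F F' K M) K →* H2Units (stabilizer Gal(F'/F) M) F' :=
  H2.map (stabilizerToRelGal F F' K M) (continuous_stabilizerToRelGal F F' K M)
    (Units.map (algebraMap K F')) (fun g a => Units.ext
      (AlgEquiv.restrictNormalHom_apply K.toIntermediateField (g : Gal(F'/F)) a))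

end Rationality

namespace Datum

variable {C : Type u} [Category.{v} C] [Abelian C] [Linear F' C]
  [GammaCategory Gal(F'/F) C] [IsAdditive Gal(F'/F) C] [IsSemilinear Gal(F'/F) F' C]

/-- `N` is a `K`-form of `M`: there is an isomorphism `F' ⊗_K N ≅ M`. -/
def IsForm (D : Datum.{w, w', u, v, u', v'} F F' C) (M : C) (K : FiniteGaloisIntermediateField F F')
    (N : D.cat K) : Prop :=
  Nonempty ((D.top K).obj N ≅ M)

/-- `c` is the class in `H²(Γ_M, F'ˣ)` that is constructed from the `K`-form `N` of `M`:
the image of the Borel--Tits class of `N` in `H²(Γ_{K/F(M)}, Kˣ)`. -/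
def IsBorelTitsClassOf (D : Datum.{w, w', u, v, u', v'} F F' C) (M : C)
    (K : FiniteGaloisIntermediateField F F') (N : D.cat K)
    (c : H2Units (stabilizer Gal(F'/F) M) F') : Prop :=
  ∃ b : H2Units (relGal F F' K M) K,
    IsFiniteBorelTitsClass (relGal F F' K M) K N b ∧ inflation F F' K M b = c

/-- `M` admits a descent datum: some `(M, φ)` lies in `DD(C)`. -/
def AdmitsDescentDatum (D : Datum.{w, w', u, v, u', v'} F F' C) (M : C) : Prop :=
  ∃ X : DescentSystem Gal(F'/F) C, D.DD X ∧ X.obj = M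

end Datum

end Data

end BorelTits

namespace BorelTits

attribute [local instance] Units.mulDistribMulActionRight

open GammaCategory

/-! ### Objects with only scalar endomorphisms. -/

section Scalar

variable (L : Type w') [Field L] {C : Type u} [Category.{v} C] [Preadditive C] [Linear L C]

/-! The class is computed by a factor set. A `K`-form `N` of `M` again has only scalar
endomorphisms, since `Hom` commutes with extension of scalars (`isScalar_of_map`), and it is
isomorphic to its conjugates under `Γ_{K/F(M)}` (`IsForm.nonempty_twist_iso`). Chosen isomorphisms
`p σ : ^σ N ≅ N` satisfy the descent condition up to scalars `f (σ, τ)`, and these form a 2-cocycle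
(`IsFactorSet.isMulCocycle₂`) whose class depends only on the isomorphism class of `N`
(`IsFactorSet.exists_coboundary`).

The `p σ` identify `Res N` with a power of `N`. Its structure isomorphisms become matrices `P σ`
with cocycle `f⁻¹`, and its endomorphisms are the matrices fixed by the twisted Galois action that
`P` defines. By Galois descent the endomorphism algebra is split by `K` with class `[f]⁻¹`
(`isBrauerClass_end`). By Skolem–Noether an algebra has only one class (`IsBrauerClass.unique`), so
the Borel–Tits class of `N` is exactly `[f]` (`isFiniteBorelTitsClass_iff`).

Independence of the form is then a statement about factor sets: two forms become isomorphic over the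
compositum of their fields, and factor sets are compatible with base change
(`Datum.inflation_eq_of_isForm`).

A descent datum on `M` comes from a descent system over `K`, whose underlying object is a form with
factor set `1`; so the class is trivial. Conversely, if `M` is self-conjugate and the class is
trivial, the trivializing continuous cochain already lives on a finite extension `E`
(`exists_finite_coboundary`). Rescaling the isomorphisms over `E` by it gives a descent system
there, and its image in `DS(C)` lies in `DD(C)` and can be moved onto `M`. -/

/-- A nonzero object whose endomorphisms are the elements of `L`. -/
structure IsScalar (N : C) : Prop where
  not_isZero : ¬ IsZero N
  exists_smul : ∀ f : N ⟶ N, ∃ c : L, f = c • 𝟙 N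

namespace IsScalar

variable {L} {N : C}

lemma smul_hom_injective (hN : IsScalar L N) {X : C} (e : X ≅ N) {c d : L}
    (h : c • e.hom = d • e.hom) : c = d := by
  by_contra hcd
  refine hN.not_isZero ((IsZero.iff_id_eq_zero N).2 ?_)
  have h₁ : (c - d) • e.hom = 0 := by rw [sub_smul, h, sub_self]
  have h₂ : e.hom = 0 := (smul_eq_zero.1 h₁).resolve_left (sub_ne_zero.2 hcd)
  rw [← e.inv_hom_id, h₂, comp_zero]

lemma exists_smul_hom (hN : IsScalar L N) {X : C} (e : X ≅ N) (f : X ⟶ N) :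
    ∃ c : L, f = c • e.hom := by
  obtain ⟨c, hc⟩ := hN.exists_smul (e.inv ≫ f)
  refine ⟨c, ?_⟩
  rw [← cancel_epi e.inv, hc, Linear.comp_smul, e.inv_hom_id]

lemma exists_units_smul_hom (hN : IsScalar L N) {X : C} (e f : X ≅ N) :
    ∃ c : Lˣ, f.hom = (c : L) • e.hom := by
  obtain ⟨c, hc⟩ := hN.exists_smul_hom e f.hom
  refine ⟨Units.mk0 c ?_, hc⟩
  rintro rfl
  refine hN.not_isZero ((IsZero.iff_id_eq_zero N).2 ?_)
  rw [← f.inv_hom_id, hc, zero_smul, comp_zero]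

lemma of_iso (hN : IsScalar L N) {X : C} (e : X ≅ N) : IsScalar L X where
  not_isZero h := hN.not_isZero (h.of_iso e.symm)
  exists_smul f := by
    obtain ⟨c, hc⟩ := hN.exists_smul_hom e (f ≫ e.hom)
    refine ⟨c, ?_⟩
    rw [← cancel_mono e.hom, hc, Linear.smul_comp, Category.id_comp]

end IsScalar

end Scalar

/-! ### Factor sets, and their classes as the obstruction to descent. -/

section FactorSet

variable {Γ : Type w} [Group Γ] {L : Type w'} [Field L] {C : Type u} [Category.{v} C]
  [Preadditive C] [Linear L C] [GammaCategory Γ C]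

/-- `f` is the factor set of the isomorphisms `p σ : ^σ N ≅ N`, i.e.
`p σ ∘ ^σ (p τ) = f (σ, τ) • p (στ) ∘ μ`. -/
def IsFactorSet {N : C} (p : ∀ σ : Γ, (twist σ).obj N ≅ N) (f : Γ × Γ → Lˣ) : Prop :=
  ∀ ⦃σ τ ρ : Γ⦄ (h : σ * τ = ρ), (twist σ).map (p τ).hom ≫ (p σ).hom =
    (f (σ, τ) : L) • ((mu h).hom.app N ≫ (p ρ).hom)

lemma exists_isFactorSet {N : C} (hN : IsScalar L N) (p : ∀ σ : Γ, (twist σ).obj N ≅ N) :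
    ∃ f : Γ × Γ → Lˣ, IsFactorSet p f := by
  choose f hf using fun σ τ : Γ => hN.exists_units_smul_hom
    ((mu (rfl : σ * τ = σ * τ)).app N ≪≫ p (σ * τ)) ((twist σ).mapIso (p τ) ≪≫ p σ)
  refine ⟨fun s => f s.1 s.2, ?_⟩
  rintro σ τ _ rfl
  exact hf σ τ

variable [MulSemiringAction Γ L] [IsSemilinear Γ L C]

/-- The composite `^σ(^τ(^ρ N)) ⟶ N` can be contracted from the outer pair or from the inner pair.
Contracting inside puts a scalar under `^σ`, which produces `σ • f (τ, ρ)` by semilinearity;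
associativity of `μ` makes the remaining isomorphisms agree. -/
lemma IsFactorSet.isMulCocycle₂ {N : C} (hN : IsScalar L N)
    {p : ∀ σ : Γ, (twist σ).obj N ≅ N} {f : Γ × Γ → Lˣ} (hf : IsFactorSet p f) :
    groupCohomology.IsMulCocycle₂ f := by
  intro σ τ ρ
  refine Units.ext ?_
  have h₁ : (twist σ).map ((twist τ).map (p ρ).hom) ≫ (twist σ).map (p τ).hom ≫ (p σ).hom =
      ((f (σ * τ, ρ) * f (σ, τ) : Lˣ) : L) • ((mu (rfl : σ * τ = σ * τ)).hom.app _ ≫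
        (mu (rfl : σ * τ * ρ = σ * τ * ρ)).hom.app N ≫ (p (σ * τ * ρ)).hom) := by
    have nat := (mu (rfl : σ * τ = σ * τ)).hom.naturality (p ρ).hom
    simp only [Functor.comp_map] at nat
    rw [hf rfl, Linear.comp_smul, reassoc_of% nat, hf rfl, Linear.comp_smul, smul_smul,
      Units.val_mul, mul_comm]
  have h₂ : (twist σ).map ((twist τ).map (p ρ).hom) ≫ (twist σ).map (p τ).hom ≫ (p σ).hom =
      ((σ • f (τ, ρ) * f (σ, τ * ρ) : Lˣ) : L) • ((mu (rfl : σ * τ = σ * τ)).hom.app _ ≫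
        (mu (rfl : σ * τ * ρ = σ * τ * ρ)).hom.app N ≫ (p (σ * τ * ρ)).hom) := by
    rw [← Category.assoc, ← Functor.map_comp, hf rfl, IsSemilinear.map_smul, Linear.smul_comp,
      Functor.map_comp, Category.assoc, hf (mul_assoc σ τ ρ).symm, Linear.comp_smul, smul_smul]
    rw [← Category.assoc, assoc rfl rfl (mul_assoc σ τ ρ).symm rfl, Category.assoc]
    rfl
  exact hN.smul_hom_injective ((mu (rfl : σ * τ = σ * τ)).app ((twist ρ).obj N) ≪≫
    (mu (rfl : σ * τ * ρ = σ * τ * ρ)).app N ≪≫ p (σ * τ * ρ)) (h₁.symm.trans h₂)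

/-- The scalar `x σ` measures how far `e` is from intertwining `p' σ` and `p σ`. Thus the class of a
factor set depends neither on the chosen isomorphisms nor on the representative of the isomorphism
class of `N`. -/
lemma IsFactorSet.exists_coboundary {N N' : C} (hN : IsScalar L N) (e : N' ≅ N)
    {p : ∀ σ : Γ, (twist σ).obj N ≅ N} {p' : ∀ σ : Γ, (twist σ).obj N' ≅ N'} {f f' : Γ × Γ → Lˣ}
    (hf : IsFactorSet p f) (hf' : IsFactorSet p' f') :
    ∃ x : Γ → Lˣ, ∀ σ τ, σ • x τ / x (σ * τ) * x σ = f (σ, τ) / f' (σ, τ) := by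
  choose x hx using fun σ => hN.exists_units_smul_hom (p' σ ≪≫ e)
    ((twist σ).mapIso e ≪≫ p σ)
  simp only [Iso.trans_hom, Functor.mapIso_hom] at hx
  refine ⟨x, fun σ τ => ?_⟩
  have nat := (mu (rfl : σ * τ = σ * τ)).hom.naturality e.hom
  simp only [Functor.comp_map] at nat
  have h₁ : (twist σ).map ((twist τ).map e.hom) ≫ (twist σ).map (p τ).hom ≫ (p σ).hom =
      ((σ • x τ * x σ * f' (σ, τ) : Lˣ) : L) •
        ((mu (rfl : σ * τ = σ * τ)).hom.app N' ≫ (p' (σ * τ)).hom ≫ e.hom) := by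
    rw [← Category.assoc, ← Functor.map_comp, hx, IsSemilinear.map_smul, Linear.smul_comp,
      Functor.map_comp, Category.assoc, hx, Linear.comp_smul, ← Category.assoc, hf' rfl,
      Linear.smul_comp, Category.assoc, smul_smul, smul_smul]
    rfl
  have h₂ : (twist σ).map ((twist τ).map e.hom) ≫ (twist σ).map (p τ).hom ≫ (p σ).hom =
      ((f (σ, τ) * x (σ * τ) : Lˣ) : L) •
        ((mu (rfl : σ * τ = σ * τ)).hom.app N' ≫ (p' (σ * τ)).hom ≫ e.hom) := by
    rw [hf rfl, Linear.comp_smul, reassoc_of% nat, hx, Linear.comp_smul, smul_smul]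
    rfl
  have h := Units.ext (hN.smul_hom_injective ((mu (rfl : σ * τ = σ * τ)).app N' ≪≫
    p' (σ * τ) ≪≫ e) (h₁.symm.trans h₂))
  rw [div_mul_eq_mul_div, div_eq_div_iff_mul_eq_mul, h]

end FactorSet

/-! ### Factor sets under base change. -/

section BaseChange

variable {Γ : Type w} [Group Γ] {Γ' : Type w'} [Group Γ'] {r : Γ →* Γ'}
  {C : Type u} [Category.{v} C] [GammaCategory Γ' C]
  {D : Type u'} [Category.{v'} D] [GammaCategory Γ D] {T : C ⥤ D}

/-- Isomorphisms `^σ N ≅ N` induce isomorphisms `^σ (T N) ≅ T N`. -/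
def TwistCompat.mapTwistIso (a : TwistCompat r T) {N : C} (p : ∀ σ : Γ', (twist σ).obj N ≅ N)
    (σ : Γ) : (twist σ).obj (T.obj N) ≅ T.obj N :=
  (a.α σ).app N ≪≫ T.mapIso (p (r σ))

/-- Associativity of `α` exchanges the `μ` of the target category for the image of the `μ` of the
source, and linearity of `T` along `i` moves the scalar out. -/
lemma TwistCompat.isFactorSet_mapTwistIso (a : TwistCompat r T)
    {K : Type*} [Field K] [Preadditive C] [Linear K C]
    {L : Type*} [Field L] [Preadditive D] [Linear L D] (i : K →+* L) (hT : IsLinearAlong i T)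
    {N : C} {p : ∀ σ : Γ', (twist σ).obj N ≅ N} {f : Γ' × Γ' → Kˣ} (hf : IsFactorSet p f) :
    IsFactorSet (a.mapTwistIso p) (fun s => Units.map (i : K →* L) (f (r s.1, r s.2))) := by
  rintro σ τ _ rfl
  have nat := (a.α σ).hom.naturality (p (r τ)).hom
  simp only [Functor.comp_map] at nat
  simp only [mapTwistIso, Iso.trans_hom, Iso.app_hom, Functor.mapIso_hom, Functor.map_comp,
    Category.assoc]
  rw [reassoc_of% nat, ← T.map_comp, hf (map_mul r σ τ).symm,
    IsLinearAlong.map_smul (i := i), ← Category.assoc ((mu rfl).hom.app _), a.assoc]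
  simp only [Linear.comp_smul, Functor.map_comp, Category.assoc]
  rfl

/-- Restriction of `TwistCompat` to subgroups. -/
def TwistCompat.restrict (a : TwistCompat r T) (H : Subgroup Γ) (H' : Subgroup Γ')
    (h : ∀ σ : H, (r.comp H.subtype) σ ∈ H') :
    TwistCompat ((r.comp H.subtype).codRestrict H' h) T where
  α σ := a.α (σ : Γ)
  assoc σ τ X := a.assoc (σ : Γ) (τ : Γ) X

end BaseChange

/-! ### Galois descent for algebras with a twisted action on matrices -/

section Descent

variable (G : Type*) [Group G] [Finite G] (L : Type*) [Field L] [MulSemiringAction G L]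

/-- Independence of the elements of `G`: the vectors `(σ b)_σ`, for `b ∈ L`, span `L ^ G`. -/
lemma exists_finsupp_sum_smul [FaithfulSMul G L] [DecidableEq G] :
    ∃ c : L →₀ L, ∀ σ : G, (c.sum fun b a => a * σ • b) = if σ = 1 then 1 else 0 := by
  have := Fintype.ofFinite G
  have htop : Submodule.span L (Set.range fun (b : L) (σ : G) => σ • b) = ⊤ := by
    by_contra h
    -- A nonzero functional vanishing on the span would be a linear relation between the distinct
    -- automorphisms `σ`, which Dedekind's independence of characters forbids.
    obtain ⟨φ, hφ, hle⟩ := Submodule.exists_le_ker_of_lt_top _ (lt_top_iff_ne_top.2 h)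
    refine hφ (LinearMap.pi_ext' fun σ => LinearMap.ext_ring ?_)
    have hinj : Function.Injective fun σ : G =>
        ((MulSemiringAction.toRingHom G L σ : L →+* L) : L →* L) := fun σ τ h =>
      FaithfulSMul.eq_of_smul_eq_smul (α := L) fun x => DFunLike.congr_fun h x
    have hli := (linearIndependent_monoidHom L L).comp _ hinj
    refine Fintype.linearIndependent_iff.1 hli (fun σ => φ (Pi.single σ 1)) (funext fun b => ?_) σ
    have hb : φ (fun σ : G => σ • b) = 0 := hle (Submodule.subset_span ⟨b, rfl⟩)
    rw [LinearMap.pi_apply_eq_sum_univ φ] at hb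
    rw [Finset.sum_apply]
    refine Eq.trans (Finset.sum_congr rfl fun σ _ => ?_) hb
    refine Eq.trans (mul_comm _ _) ?_
    change σ • b * _ = σ • b * _
    congr 2
    ext τ
    rw [Pi.single_apply]
    exact if_congr eq_comm rfl rfl
  have h1 : (Pi.single 1 1 : G → L) ∈
      Submodule.span L (Set.range fun (b : L) (σ : G) => σ • b) := htop ▸ trivial
  obtain ⟨c, hc⟩ := Finsupp.mem_span_range_iff_exists_finsupp.1 h1
  refine ⟨c, fun σ => ?_⟩
  have := congrFun hc σ
  simpa [Finsupp.sum, Pi.single_apply] using this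

variable {G L}

/-- The entrywise action of `σ` on matrices. -/
abbrev matrixAction {n : Type*} [Fintype n] [DecidableEq n] (σ : G) :
    Matrix n n L →+* Matrix n n L :=
  (MulSemiringAction.toRingHom G L σ).mapMatrix

omit [Finite G] in
lemma matrixAction_smul {n : Type*} [Fintype n] [DecidableEq n] (σ : G) (a : L)
    (m : Matrix n n L) : matrixAction σ (a • m) = (σ • a) • matrixAction σ m := by
  ext i j
  simp [matrixAction]

omit [Finite G] in
lemma matrixAction_mul {n : Type*} [Fintype n] [DecidableEq n] (σ τ : G)
    (m : Matrix n n L) : matrixAction (σ * τ) m = matrixAction σ (matrixAction τ m) := by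
  ext i j
  simp [matrixAction, mul_smul]

variable {A : Type*} [Ring A] [Algebra (FixedPoints.subfield G L) A]
  {n : Type*} [Fintype n] [DecidableEq n]

/-- The `L`-algebra homomorphism on `L ⊗ A` that extends `j`. -/
def liftMatrix (j : A →ₐ[FixedPoints.subfield G L] Matrix n n L) :
    L ⊗[FixedPoints.subfield G L] A →ₐ[L] Matrix n n L :=
  Algebra.TensorProduct.lift (Algebra.ofId L (Matrix n n L)) j fun a x => Algebra.commutes a (j x)

omit [Finite G] in
lemma liftMatrix_tmul (j : A →ₐ[FixedPoints.subfield G L] Matrix n n L) (a : L) (x : A) :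
    liftMatrix j (a ⊗ₜ x) = a • j x :=
  (Algebra.TensorProduct.lift_tmul _ _ _ _ _).trans (Algebra.smul_def a (j x)).symm

/-- Galois descent: if `j` identifies `A` with the fixed points of the semilinear action
`m ↦ P σ * σ m * (P σ)⁻¹` on matrices, then `L ⊗ A` is the matrix algebra. -/
theorem bijective_lift_of_fixedPoints [FaithfulSMul G L] (P : G → GL n L) (f : G × G → Lˣ)
    (hP : ∀ σ τ : G, (P σ : Matrix n n L) * matrixAction σ (P τ : Matrix n n L) =
      (f (σ, τ) : L) • (P (σ * τ) : Matrix n n L))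
    (j : A →ₐ[FixedPoints.subfield G L] Matrix n n L) (hj : Function.Injective j)
    (hrange : ∀ m : Matrix n n L, m ∈ Set.range j ↔
      ∀ σ, (P σ : Matrix n n L) * matrixAction σ m = m * P σ) :
    Function.Bijective (liftMatrix j) := by
  classical
  have := Fintype.ofFinite G
  obtain ⟨c, hc⟩ := exists_finsupp_sum_smul G L
  set ρ : G → Matrix n n L → Matrix n n L := fun σ m =>
    (P σ : Matrix n n L) * matrixAction σ m * ((P σ)⁻¹ : GL n L) with hρ
  have hρ_mul : ∀ σ τ m, ρ σ (ρ τ m) = ρ (σ * τ) m := by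
    intro σ τ m
    -- The cocycle `f` is scalar, so it cancels in conjugation and `ρ` is a genuine action.
    have h1 : ((P σ : Matrix n n L) * matrixAction σ (P τ : Matrix n n L)) *
        (matrixAction σ ((P τ)⁻¹ : GL n L).1 * ((P σ)⁻¹ : GL n L).1) = 1 := by
      rw [mul_assoc, ← mul_assoc (matrixAction σ _), ← map_mul, ← Units.val_mul,
        mul_inv_cancel, Units.val_one, map_one, one_mul, ← Units.val_mul, mul_inv_cancel,
        Units.val_one]
    have h2 : (matrixAction σ (((P τ)⁻¹ : GL n L) : Matrix n n L) *
        (((P σ)⁻¹ : GL n L) : Matrix n n L)) =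
        ((f (σ, τ))⁻¹ : Lˣ).1 • (((P (σ * τ))⁻¹ : GL n L) : Matrix n n L) := by
      rw [hP] at h1
      have h3 := congrArg (fun m => ((f (σ, τ))⁻¹ : Lˣ).1 •
        (((P (σ * τ))⁻¹ : GL n L) : Matrix n n L) * m) h1
      simp only [mul_one, ← mul_assoc, smul_mul_assoc, mul_smul_comm, smul_smul] at h3
      rw [← Units.val_mul, ← Units.val_mul] at h3
      simpa [smul_smul] using h3
    simp only [hρ, map_mul, ← matrixAction_mul]
    rw [show ∀ a b c d e : Matrix n n L, a * (b * c * d) * e = (a * b) * c * (d * e) by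
      intros; simp only [mul_assoc], hP, h2]
    simp [smul_smul]
  have hρ_add : ∀ σ m m', ρ σ (m + m') = ρ σ m + ρ σ m' := by
    intro σ m m'
    simp only [hρ, map_add, mul_add, add_mul]
  have hρ_smul : ∀ σ (a : L) m, ρ σ (a • m) = (σ • a) • ρ σ m := by
    intro σ a m
    simp only [hρ, matrixAction_smul, smul_mul_assoc, mul_smul_comm]
  have hρ_j : ∀ m : Matrix n n L, m ∈ Set.range j ↔ ∀ σ, ρ σ m = m := by
    intro m
    rw [hrange]
    exact forall_congr' fun σ => (Units.mul_inv_eq_iff_eq_mul (P σ)).symm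
  -- `P 1` need not be the identity matrix; `ρ 1` is the identity because it is injective and
  -- idempotent.
  have hρ_one : ∀ m, ρ 1 m = m := by
    intro m
    have h1 : Function.Injective (ρ 1) := by
      intro x y hxy
      simp only [hρ] at hxy
      have h2 := (Units.mul_right_inj _).1 ((Units.mul_left_inj _).1 hxy)
      ext i k
      have := congrFun (congrFun h2 i) k
      simpa [matrixAction] using this
    exact h1 (by rw [hρ_mul, one_mul])
  have hρ_sum : ∀ σ (s : Finset G) (g : G → Matrix n n L),
      ρ σ (∑ τ ∈ s, g τ) = ∑ τ ∈ s, ρ σ (g τ) := fun σ s g =>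
    map_sum (AddMonoidHom.mk' (ρ σ) (hρ_add σ)) g s
  -- The trace of `b • m` is fixed by `ρ`, so it comes from `A`; call its preimage `wt b m`.
  have hex : ∀ (b : L) (m : Matrix n n L), ∃ x : A, j x = ∑ σ, ρ σ (b • m) := by
    intro b m
    refine (hρ_j _).2 fun τ => ?_
    rw [hρ_sum]
    simp only [hρ_mul]
    exact Fintype.sum_equiv (Equiv.mulLeft τ) _ _ fun σ => rfl
  choose wt hwt using hex
  constructor
  -- An explicit inverse: weight the traces by the coefficients `c b`. Since `∑ c b * σ b` is `1`
  -- for `σ = 1` and `0` otherwise, only the term `σ = 1` of each trace survives.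
  · have hinv : ∀ t : L ⊗[FixedPoints.subfield G L] A,
        t = ∑ b ∈ c.support, (c b) ⊗ₜ wt b (liftMatrix j t) := by
      intro t
      induction t using TensorProduct.induction_on with
      | zero =>
        have : ∀ b, wt b 0 = 0 := fun b => hj (by rw [hwt, map_zero]; simp [hρ])
        simp [this]
      | add x y hx hy =>
        have : ∀ b m m', wt b (m + m') = wt b m + wt b m' := fun b m m' => hj (by
          rw [map_add, hwt, hwt, hwt, ← Finset.sum_add_distrib]
          exact Finset.sum_congr rfl fun σ _ => by rw [smul_add, hρ_add])
        rw [map_add]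
        simp only [this, TensorProduct.tmul_add, Finset.sum_add_distrib]
        rw [← hx, ← hy]
      | tmul a x =>
        have htr : ∀ b : L, (∑ σ : G, σ • (b * a)) ∈ FixedPoints.subfield G L := by
          intro b τ
          rw [Finset.smul_sum]
          simp only [smul_smul]
          exact Fintype.sum_equiv (Equiv.mulLeft τ) _ _ fun σ => rfl
        have hwx : ∀ b : L, wt b (liftMatrix j (a ⊗ₜ x)) =
            (⟨_, htr b⟩ : FixedPoints.subfield G L) • x := by
          intro b
          refine hj ?_
          rw [hwt, map_smul, liftMatrix_tmul]
          have hx := (hρ_j (j x)).1 ⟨x, rfl⟩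
          simp only [smul_smul, hρ_smul, hx]
          rw [← Finset.sum_smul]
          rfl
        simp only [hwx, ← TensorProduct.smul_tmul]
        rw [← TensorProduct.sum_tmul]
        congr 1
        have : ∀ b : L, (⟨_, htr b⟩ : FixedPoints.subfield G L) • c b =
            ∑ σ : G, (σ • a) * (c b * σ • b) := by
          intro b
          change (∑ σ : G, σ • (b * a)) * c b = _
          rw [Finset.sum_mul]
          refine Finset.sum_congr rfl fun σ _ => ?_
          rw [smul_mul']
          ring
        simp only [this]
        rw [Finset.sum_comm]
        simp only [← Finset.mul_sum]
        have : ∀ σ : G, ∑ b ∈ c.support, c b * σ • b = if σ = 1 then 1 else 0 := hc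
        simp [this]
    intro x y hxy
    rw [hinv x, hinv y, hxy]
  -- The same weighted sum of traces is a preimage of `m`.
  · intro m
    refine ⟨∑ b ∈ c.support, (c b) ⊗ₜ wt b m, ?_⟩
    rw [map_sum]
    simp only [liftMatrix_tmul, hwt, Finset.smul_sum, hρ_smul, smul_smul]
    rw [Finset.sum_comm]
    simp only [← Finset.sum_smul]
    have : ∀ σ : G, ∑ b ∈ c.support, c b * σ • b = if σ = 1 then 1 else 0 := hc
    simp [this, hρ_one]

end Descent

/-! ### Existence and uniqueness of the Brauer class of a split algebra. -/

section BrauerClass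

variable {G : Type*} [Group G] [TopologicalSpace G] {L : Type*} [Field L]
  [MulSemiringAction G L] {A : Type*} [Ring A] [Algebra (FixedPoints.subfield G L) A]

/-- The splitting is the linear extension of `j`. It carries `σ ⊗ 1` to the twisted action of `P`,
because `j x` is fixed by that action. -/
theorem isBrauerClass_of_fixedPoints [Finite G] [FaithfulSMul G L] {n : ℕ} (hn : 0 < n)
    (P : G → GL (Fin n) L)
    (f : contCocycles₂ G Lˣ)
    (hP : ∀ σ τ : G, (P σ : Matrix (Fin n) (Fin n) L) * matrixAction σ (P τ).1 =
      (f.1 (σ, τ) : L) • (P (σ * τ) : Matrix (Fin n) (Fin n) L))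
    (j : A →ₐ[FixedPoints.subfield G L] Matrix (Fin n) (Fin n) L) (hj : Function.Injective j)
    (hrange : ∀ m : Matrix (Fin n) (Fin n) L, m ∈ Set.range j ↔
      ∀ σ, (P σ : Matrix (Fin n) (Fin n) L) * matrixAction σ m = m * P σ) :
    IsBrauerClass G L A (H2.mk f) := by
  refine ⟨n, hn, AlgEquiv.ofBijective _ (bijective_lift_of_fixedPoints P f.1 hP j hj hrange), P, f,
    fun σ a x => ?_, hP, rfl⟩
  have hx := (hrange (j x)).1 ⟨x, rfl⟩ σ
  have h₁ : ∀ a : L, AlgEquiv.ofBijective _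
      (bijective_lift_of_fixedPoints P f.1 hP j hj hrange) (a ⊗ₜ x) = a • j x := by
    intro a
    rw [AlgEquiv.ofBijective_apply, liftMatrix_tmul]
  rw [h₁, h₁]
  change _ = (P σ : Matrix (Fin n) (Fin n) L) * matrixAction σ (a • j x) * _
  rw [matrixAction_smul, mul_smul_comm, hx, smul_mul_assoc, Units.mul_inv_cancel_right]

/-- Automorphisms of matrix algebras are inner. -/
lemma exists_conj_of_algEquiv {n : Type*} [Fintype n] [DecidableEq n]
    (θ : Matrix n n L ≃ₐ[L] Matrix n n L) :
    ∃ Q : GL n L, ∀ m, θ m * Q = Q * m := by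
  obtain ⟨T, hT⟩ := LinearEquiv.conjAlgEquiv_surjective L (n → L) (n → L)
    ((Matrix.toLinAlgEquiv'.symm.trans θ).trans Matrix.toLinAlgEquiv')
  refine ⟨⟨LinearMap.toMatrixAlgEquiv' T.toLinearMap,
    LinearMap.toMatrixAlgEquiv' T.symm.toLinearMap,
    ?_, ?_⟩, fun m => ?_⟩
  · rw [← map_mul, ← map_one LinearMap.toMatrixAlgEquiv']
    exact congrArg _ (LinearMap.ext T.apply_symm_apply)
  · rw [← map_mul, ← map_one LinearMap.toMatrixAlgEquiv']
    exact congrArg _ (LinearMap.ext T.symm_apply_apply)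
  · have h := DFunLike.congr_fun hT (Matrix.toLinAlgEquiv' m)
    simp only [AlgEquiv.trans_apply, AlgEquiv.symm_apply_apply] at h
    apply Matrix.toLinAlgEquiv'.injective
    change Matrix.toLinAlgEquiv' (θ m * LinearMap.toMatrixAlgEquiv' T.toLinearMap) =
      Matrix.toLinAlgEquiv' (LinearMap.toMatrixAlgEquiv' T.toLinearMap * m)
    rw [map_mul Matrix.toLinAlgEquiv', map_mul Matrix.toLinAlgEquiv', ← h,
      Matrix.toLinAlgEquiv'_toMatrixAlgEquiv']
    refine LinearMap.ext fun v => ?_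
    simp [LinearEquiv.conjAlgEquiv_apply]

omit [TopologicalSpace G] in
lemma matrixAction_surjective {n : Type*} [Fintype n] [DecidableEq n] (σ : G) :
    Function.Surjective (matrixAction σ : Matrix n n L →+* Matrix n n L) := fun m =>
  ⟨m.map fun y => σ⁻¹ • y, by ext; simp [matrixAction]⟩

/-- By Skolem–Noether two splittings differ by conjugation with some `Q`. Then `P' σ * σ Q` and `Q *
P σ` induce the same semilinear map, so they differ by a scalar `x σ`, and `x` is the cochain
relating the two cocycles. -/
theorem IsBrauerClass.unique [Finite G] [DiscreteTopology G] {c c' : H2Units G L}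
    (h : IsBrauerClass G L A c) (h' : IsBrauerClass G L A c') : c = c' := by
  obtain ⟨n, hn, ψ, P, f, hψ, hP, rfl⟩ := h
  obtain ⟨n', hn', ψ', P', f', hψ', hP', rfl⟩ := h'
  obtain rfl : n = n' := by
    have := (ψ.symm.trans ψ').toLinearEquiv.finrank_eq
    simp only [Module.finrank_matrix, Fintype.card_fin, Module.finrank_self, mul_one] at this
    exact Nat.mul_self_inj.1 this
  -- Positivity of `n` is what makes invertible matrices nonzero, so that scalars in front of them
  -- can be compared.
  have : Nonempty (Fin n) := ⟨⟨0, hn⟩⟩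
  obtain ⟨Q, hQ⟩ := exists_conj_of_algEquiv (ψ.symm.trans ψ')
  have hQ' : ∀ y, ψ' y * Q = Q * ψ y := fun y => by simpa using hQ (ψ y)
  -- the action of `σ` on `L ⊗ A`
  let s : G → (L ⊗[FixedPoints.subfield G L] A) →ₗ[FixedPoints.subfield G L]
      (L ⊗[FixedPoints.subfield G L] A) := fun σ =>
    TensorProduct.map
      { toFun := fun a => σ • a
        map_add' := smul_add σ
        map_smul' := fun k a => by
          change σ • ((k : L) * a) = (k : L) * σ • a
          rw [smul_mul', k.2 σ] } LinearMap.id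
  have hs : ∀ σ y, ψ (s σ y) * P σ = P σ * matrixAction σ (ψ y) := by
    intro σ y
    induction y using TensorProduct.induction_on with
    | zero => simp
    | add x y hx hy => simp only [map_add, mul_add, add_mul, hx, hy]
    | tmul a x =>
      change ψ ((σ • a) ⊗ₜ x) * _ = _
      rw [hψ, Units.inv_mul_cancel_right]
      rfl
  have hs' : ∀ σ y, ψ' (s σ y) * P' σ = P' σ * matrixAction σ (ψ' y) := by
    intro σ y
    induction y using TensorProduct.induction_on with
    | zero => simp
    | add x y hx hy => simp only [map_add, mul_add, add_mul, hx, hy]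
    | tmul a x =>
      change ψ' ((σ • a) ⊗ₜ x) * _ = _
      rw [hψ', Units.inv_mul_cancel_right]
      rfl
  let Qs : G → GL (Fin n) L := fun σ => Units.map (matrixAction σ).toMonoidHom Q
  have hx : ∀ σ : G, ∃ x : Lˣ, (P' σ).1 * matrixAction σ Q.1 = (x : L) • (Q.1 * (P σ).1) := by
    intro σ
    -- The quotient of the two matrices is central, hence scalar. It is enough to test it on the
    -- matrices `σ (ψ y)`, which exhaust all matrices.
    have hcomm : ∀ m : Matrix (Fin n) (Fin n) L,
        Commute m (((Q * P σ)⁻¹ * (P' σ * Qs σ) : GL (Fin n) L) : Matrix (Fin n) (Fin n) L) := by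
      intro m
      obtain ⟨m, rfl⟩ := matrixAction_surjective σ m
      obtain ⟨y, rfl⟩ := ψ.surjective m
      have h₁ : (P' σ * Qs σ).1 * matrixAction σ (ψ y) = ψ' (s σ y) * (P' σ * Qs σ).1 := by
        change (P' σ).1 * matrixAction σ Q.1 * matrixAction σ (ψ y) =
          ψ' (s σ y) * ((P' σ).1 * matrixAction σ Q.1)
        rw [mul_assoc, ← map_mul, ← hQ', map_mul, ← mul_assoc, ← hs', mul_assoc]
      have h₂ : (Q * P σ).1 * matrixAction σ (ψ y) = ψ' (s σ y) * (Q * P σ).1 := by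
        change Q.1 * (P σ).1 * matrixAction σ (ψ y) = ψ' (s σ y) * (Q.1 * (P σ).1)
        rw [mul_assoc, ← hs, ← mul_assoc, ← hQ', mul_assoc]
      have h₃ : matrixAction σ (ψ y) * ((Q * P σ)⁻¹ : GL (Fin n) L).1 =
          ((Q * P σ)⁻¹ : GL (Fin n) L).1 * ψ' (s σ y) := by
        rw [Units.mul_inv_eq_iff_eq_mul, mul_assoc, ← h₂, Units.inv_mul_cancel_left]
      rw [commute_iff_eq, Units.val_mul, ← mul_assoc, h₃, mul_assoc, mul_assoc, h₁]
    obtain ⟨x, hx⟩ := Matrix.mem_range_scalar_iff_commute_single'.2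
      fun i k => hcomm (Matrix.single i k 1)
    have hx₀ : x ≠ 0 := by
      rintro rfl
      rw [map_zero] at hx
      exact Units.ne_zero _ hx.symm
    refine ⟨Units.mk0 x hx₀, ?_⟩
    change (P' σ * Qs σ).1 = x • (Q * P σ).1
    have h₄ : (P' σ * Qs σ).1 = (Q * P σ).1 * ((Q * P σ)⁻¹ * (P' σ * Qs σ) : GL (Fin n) L).1 := by
      rw [← Units.val_mul, mul_inv_cancel_left]
    rw [h₄, ← hx, Matrix.scalar_apply, ← Matrix.smul_one_eq_diagonal, mul_smul_comm, mul_one]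
  choose x hx using hx
  refine QuotientGroup.eq.2 (Subgroup.mem_subgroupOf.2 ⟨x, IsLocallyConstant.of_discrete x,
    fun σ τ => ?_⟩)
  have e₁ : (P' σ).1 * matrixAction σ (P' τ).1 * matrixAction (σ * τ) Q.1 =
      ((f'.1 (σ, τ) * x (σ * τ) : Lˣ) : L) • (Q.1 * (P (σ * τ)).1) := by
    have := hP' σ τ
    change (P' σ).1 * matrixAction σ (P' τ).1 = _ at this
    rw [this, smul_mul_assoc, hx, smul_smul, Units.val_mul]
  have e₂ : (P' σ).1 * matrixAction σ (P' τ).1 * matrixAction (σ * τ) Q.1 =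
      ((σ • x τ * x σ * f.1 (σ, τ) : Lˣ) : L) • (Q.1 * (P (σ * τ)).1) := by
    have := hP σ τ
    change (P σ).1 * matrixAction σ (P τ).1 = _ at this
    rw [matrixAction_mul, mul_assoc, ← map_mul, hx, matrixAction_smul, map_mul, mul_smul_comm,
      ← mul_assoc, hx, smul_mul_assoc, mul_assoc, this, mul_smul_comm, smul_smul, smul_smul]
    rfl
  have e₃ : f'.1 (σ, τ) * x (σ * τ) = σ • x τ * x σ * f.1 (σ, τ) := by
    refine Units.ext ?_
    have := e₁.symm.trans e₂
    rw [← sub_eq_zero, ← sub_smul] at this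
    refine sub_eq_zero.1 ((smul_eq_zero.1 this).resolve_right ?_)
    exact Units.ne_zero (Q * P (σ * τ))
  change _ = (f.1 (σ, τ))⁻¹ * f'.1 (σ, τ)
  rw [div_mul_eq_mul_div, div_eq_iff_eq_mul, mul_assoc, e₃,
    mul_comm (f.1 (σ, τ))⁻¹, mul_inv_cancel_right]

end BrauerClass

/-! ### Endomorphisms of powers of a scalar object -/

section PowerDecomposition

/-- A decomposition of `R` as a power `N ^ ι`. -/
structure PowerDecomposition {C : Type u} [Category.{v} C] [Preadditive C] (ι : Type*) [Fintype ι]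
    [DecidableEq ι] (N R : C) where
  /-- The inclusions. -/
  incl : ι → (N ⟶ R)
  /-- The projections. -/
  proj : ι → (R ⟶ N)
  incl_proj : ∀ a b, incl a ≫ proj b = if a = b then 𝟙 N else 0
  sum_proj_incl : ∑ a, proj a ≫ incl a = 𝟙 R

namespace PowerDecomposition

variable {L : Type w'} [Field L] {C : Type u} [Category.{v} C] [Preadditive C] [Linear L C]
  {ι : Type*} [Fintype ι] [DecidableEq ι] {N R : C} (e : PowerDecomposition ι N R)

lemma comp_eq_sum {X Y : C} (f : X ⟶ R)
    (g : R ⟶ Y) : f ≫ g = ∑ a, (f ≫ e.proj a) ≫ (e.incl a ≫ g) := by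
  calc f ≫ g = f ≫ (∑ a, e.proj a ≫ e.incl a) ≫ g := by rw [e.sum_proj_incl, Category.id_comp]
    _ = _ := by simp only [Preadditive.sum_comp, Preadditive.comp_sum, Category.assoc]

lemma hom_ext {X : C} {f g : X ⟶ R} (h : ∀ a, f ≫ e.proj a = g ≫ e.proj a) : f = g := by
  have hf := e.comp_eq_sum f (𝟙 R)
  have hg := e.comp_eq_sum g (𝟙 R)
  rw [Category.comp_id] at hf hg
  rw [hf, hg]
  simp only [h]

lemma hom_ext' {X : C} {f g : R ⟶ X} (h : ∀ a, e.incl a ≫ f = e.incl a ≫ g) : f = g := by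
  have hf := e.comp_eq_sum (𝟙 R) f
  have hg := e.comp_eq_sum (𝟙 R) g
  rw [Category.id_comp] at hf hg
  rw [hf, hg]
  simp only [h]

/-- The image of a decomposition under an additive functor. -/
def map {D : Type u'} [Category.{v'} D] [Preadditive D] (T : C ⥤ D) [T.Additive] :
    PowerDecomposition ι (T.obj N) (T.obj R) where
  incl a := T.map (e.incl a)
  proj a := T.map (e.proj a)
  incl_proj a b := by
    rw [← T.map_comp, e.incl_proj]
    split_ifs <;> simp
  sum_proj_incl := by
    simp only [← T.map_comp]
    rw [← T.map_sum, e.sum_proj_incl, T.map_id]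

lemma comp_eq_sum_map {D : Type u'} [Category.{v'} D] [Preadditive D] (T : C ⥤ D) [T.Additive]
    {X : C} {Y : D} (f : X ⟶ R) (g : T.obj R ⟶ Y) :
    T.map f ≫ g = ∑ a, T.map (f ≫ e.proj a) ≫ (T.map (e.incl a) ≫ g) := by
  rw [(e.map T).comp_eq_sum]
  simp only [map, ← T.map_comp]

variable (hN : IsScalar L N)

/-- The matrix of an endomorphism of `R ≅ N ^ ι`. -/
def toMatrix (f : R ⟶ R) : Matrix ι ι L :=
  fun a b => (hN.exists_smul (e.incl b ≫ f ≫ e.proj a)).choose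

lemma toMatrix_spec (f : R ⟶ R) (a b : ι) :
    e.incl b ≫ f ≫ e.proj a = e.toMatrix hN f a b • 𝟙 N :=
  (hN.exists_smul (e.incl b ≫ f ≫ e.proj a)).choose_spec

lemma toMatrix_eq_iff {f : R ⟶ R} {m : Matrix ι ι L} :
    e.toMatrix hN f = m ↔ ∀ a b, e.incl b ≫ f ≫ e.proj a = m a b • 𝟙 N := by
  refine ⟨fun h a b => h ▸ e.toMatrix_spec hN f a b, fun h => Matrix.ext fun a b => ?_⟩
  exact hN.smul_hom_injective (Iso.refl N) ((e.toMatrix_spec hN f a b).symm.trans (h a b))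

lemma toMatrix_id : e.toMatrix hN (𝟙 R) = 1 := by
  refine (e.toMatrix_eq_iff hN).2 fun a b => ?_
  rw [Category.id_comp, e.incl_proj, Matrix.one_apply]
  by_cases h : a = b
  · simp [h]
  · simp [h, Ne.symm h]

lemma toMatrix_comp (f g : R ⟶ R) :
    e.toMatrix hN (f ≫ g) = e.toMatrix hN g * e.toMatrix hN f := by
  refine (e.toMatrix_eq_iff hN).2 fun a b => ?_
  rw [Category.assoc, ← Category.assoc, e.comp_eq_sum, Matrix.mul_apply, Finset.sum_smul]
  refine Finset.sum_congr rfl fun c _ => ?_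
  rw [e.toMatrix_spec hN, (Category.assoc _ _ _).trans (e.toMatrix_spec hN f c b), Linear.comp_smul,
    Category.comp_id, smul_smul]

lemma toMatrix_add (f g : R ⟶ R) :
    e.toMatrix hN (f + g) = e.toMatrix hN f + e.toMatrix hN g := by
  refine (e.toMatrix_eq_iff hN).2 fun a b => ?_
  rw [Preadditive.add_comp, Preadditive.comp_add, e.toMatrix_spec hN, e.toMatrix_spec hN, ← add_smul]
  rfl

lemma toMatrix_smul (c : L) (f : R ⟶ R) : e.toMatrix hN (c • f) = c • e.toMatrix hN f := by
  refine (e.toMatrix_eq_iff hN).2 fun a b => ?_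
  rw [Linear.smul_comp, Linear.comp_smul, e.toMatrix_spec hN, smul_smul]
  rfl

lemma toMatrix_injective : Function.Injective (e.toMatrix hN) := by
  intro f g h
  refine e.hom_ext fun a => e.hom_ext' fun b => ?_
  rw [toMatrix_spec _ hN, toMatrix_spec _ hN, h]

lemma toMatrix_surjective : Function.Surjective (e.toMatrix hN) := by
  intro m
  refine ⟨∑ c, ∑ d, m c d • (e.proj d ≫ e.incl c), (e.toMatrix_eq_iff hN).2 fun a b => ?_⟩
  simp only [Preadditive.sum_comp, Preadditive.comp_sum, Linear.smul_comp, Linear.comp_smul]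
  rw [Finset.sum_eq_single a, Finset.sum_eq_single b]
  · rw [Category.assoc, e.incl_proj, if_pos rfl, Category.comp_id, e.incl_proj, if_pos rfl]
  · intro d _ hd
    rw [Category.assoc, ← Category.assoc, e.incl_proj, if_neg hd.symm, zero_comp, smul_zero]
  · simp
  · intro c _ hc
    refine Finset.sum_eq_zero fun d _ => ?_
    rw [Category.assoc, e.incl_proj, if_neg hc, comp_zero, comp_zero, smul_zero]
  · simp

end PowerDecomposition

end PowerDecomposition

/-! ### The Brauer class of the endomorphism algebra of a descent system -/

section EndDescentSystem

variable {G : Type w} [Group G] {L : Type w'} [Field L] [MulSemiringAction G L]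
  {C : Type u} [Category.{v} C] [Preadditive C] [Linear L C] [GammaCategory G C]
  [IsAdditive G C] [IsSemilinear G L C] {R : DescentSystem G C} {N : C}
  {ι : Type*} [Fintype ι] [DecidableEq ι]

/-- The representation of the endomorphisms of a descent system on `N ^ ι` by matrices. -/
def endToMatrix (hN : IsScalar L N) (e : PowerDecomposition ι N R.obj) :
    End R →ₐ[FixedPoints.subfield G L] Matrix ι ι L :=
  AlgHom.ofLinearMap
    { toFun := fun x => e.toMatrix hN (DescentSystem.Hom.hom x)
      map_add' := fun _ _ => e.toMatrix_add hN _ _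
      map_smul' := fun c _ => e.toMatrix_smul hN (c : L) _ }
    (e.toMatrix_id hN) (fun _ _ => e.toMatrix_comp hN _ _)

-- Each entry of `φ σ` is a map `^σ N ⟶ N`, hence a multiple of `p σ`. The inverse matrix is read
-- off in the same way from `(φ σ)⁻¹`.
omit [MulSemiringAction G L] [IsSemilinear G L C] in
lemma exists_twist_matrix (hN : IsScalar L N) (e : PowerDecomposition ι N R.obj)
    (p : ∀ σ : G, (twist σ).obj N ≅ N) (σ : G) :
    ∃ P : GL ι L, ∀ a b, (twist σ).map (e.incl b) ≫ (R.φ σ).hom ≫ e.proj a =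
      (P : Matrix ι ι L) a b • (p σ).hom := by
  choose P hP using fun a b => hN.exists_smul_hom (p σ)
    ((twist σ).map (e.incl b) ≫ (R.φ σ).hom ≫ e.proj a)
  choose Q hQ using fun a b => hN.exists_smul
    ((e.incl b ≫ (R.φ σ).inv ≫ (twist σ).map (e.proj a)) ≫ (p σ).hom)
  have hQ' : ∀ a b, e.incl b ≫ (R.φ σ).inv ≫ (twist σ).map (e.proj a) = Q a b • (p σ).inv := by
    intro a b
    rw [← cancel_mono (p σ).hom, hQ, Linear.smul_comp, Iso.inv_hom_id]
  have hPQ : Matrix.of P * Matrix.of Q = 1 := by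
    rw [← e.toMatrix_id hN]
    refine ((e.toMatrix_eq_iff hN).2 fun a b => ?_).symm
    have hid : 𝟙 R.obj = (R.φ σ).inv ≫ (twist σ).map (𝟙 R.obj) ≫ (R.φ σ).hom := by simp
    rw [hid, ← e.sum_proj_incl, Functor.map_sum, Matrix.mul_apply, Finset.sum_smul]
    simp only [Preadditive.sum_comp, Preadditive.comp_sum, Functor.map_comp]
    refine Finset.sum_congr rfl fun c _ => ?_
    have h1 : e.incl b ≫ ((R.φ σ).inv ≫ ((twist σ).map (e.proj c) ≫ (twist σ).map (e.incl c)) ≫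
        (R.φ σ).hom) ≫ e.proj a = (e.incl b ≫ (R.φ σ).inv ≫ (twist σ).map (e.proj c)) ≫
          (twist σ).map (e.incl c) ≫ (R.φ σ).hom ≫ e.proj a := by simp only [Category.assoc]
    rw [h1, hQ', hP, Linear.comp_smul, Linear.smul_comp, Iso.inv_hom_id, smul_smul]
    rfl
  exact ⟨⟨Matrix.of P, Matrix.of Q, hPQ, mul_eq_one_comm.1 hPQ⟩, hP⟩

/-- In the basis given by `p`, the exact descent condition of `R` forces the matrices `P` to
compensate the failure `f` of `p`; hence the inverse. An endomorphism of `N ^ n` respects the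
descent system precisely when its matrix is fixed by the action twisted by `P`. -/
theorem isBrauerClass_end [Finite G] [FaithfulSMul G L] [TopologicalSpace G] {n : ℕ} (hn : 0 < n)
    (hN : IsScalar L N) (e : PowerDecomposition (Fin n) N R.obj)
    {p : ∀ σ : G, (twist σ).obj N ≅ N} (f : contCocycles₂ G Lˣ) (hf : IsFactorSet p f.1) :
    IsBrauerClass G L (End R) (H2.mk f)⁻¹ := by
  choose P hP using exists_twist_matrix hN e p
  refine isBrauerClass_of_fixedPoints hn P f⁻¹ (fun σ τ => ?_) (endToMatrix hN e)
    (fun x y h => DescentSystem.hom_ext (e.toMatrix_injective hN h)) (fun m => ?_)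
  -- Compare entries in the descent condition of `R`; composing `^σ (p τ)` with `p σ` contributes `f
  -- (σ, τ)`.
  · have key : (f.1 (σ, τ) : L) • ((P σ).1 * matrixAction σ (P τ).1) = (P (σ * τ)).1 := by
      ext a b
      have nat := (mu (rfl : σ * τ = σ * τ)).hom.naturality (e.incl b)
      simp only [Functor.comp_map] at nat
      refine hN.smul_hom_injective ((mu (rfl : σ * τ = σ * τ)).app N ≪≫ p (σ * τ)) ?_
      simp only [Iso.trans_hom, Iso.app_hom]
      rw [← Linear.comp_smul (r := (P (σ * τ)).1 a b), ← hP, ← reassoc_of% nat,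
        reassoc_of% (R.cond σ τ), ← Category.assoc, ← Functor.map_comp, e.comp_eq_sum_map,
        Matrix.smul_apply, Matrix.mul_apply, smul_eq_mul, Finset.mul_sum, Finset.sum_smul]
      refine Finset.sum_congr rfl fun c _ => ?_
      rw [hP, Category.assoc, hP, IsSemilinear.map_smul, Linear.comp_smul, Linear.smul_comp, hf rfl,
        smul_smul, smul_smul]
      congr 1
      simp only [matrixAction, RingHom.mapMatrix_apply, Matrix.map_apply,
        MulSemiringAction.toRingHom_apply]
      ring
    rw [← key, smul_smul]
    change _ = ((((f.1 (σ, τ))⁻¹ * f.1 (σ, τ) : Lˣ) : L)) • _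
    rw [inv_mul_cancel, Units.val_one, one_smul]
  · obtain ⟨g, rfl⟩ := e.toMatrix_surjective hN m
    have h₁ : ∀ σ a b, (twist σ).map (e.incl b) ≫ ((R.φ σ).hom ≫ g) ≫ e.proj a =
        (e.toMatrix hN g * (P σ).1) a b • (p σ).hom := by
      intro σ a b
      rw [Category.assoc, ← Category.assoc, e.comp_eq_sum, Matrix.mul_apply, Finset.sum_smul]
      refine Finset.sum_congr rfl fun c _ => ?_
      rw [(Category.assoc _ _ _).trans (hP σ c b), e.toMatrix_spec hN, Linear.comp_smul,
        Category.comp_id, smul_smul]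
    have h₂ : ∀ σ a b, (twist σ).map (e.incl b) ≫ ((twist σ).map g ≫ (R.φ σ).hom) ≫ e.proj a =
        ((P σ).1 * matrixAction σ (e.toMatrix hN g)) a b • (p σ).hom := by
      intro σ a b
      rw [Category.assoc, ← Category.assoc, ← Functor.map_comp, e.comp_eq_sum_map,
        Matrix.mul_apply, Finset.sum_smul]
      refine Finset.sum_congr rfl fun c _ => ?_
      rw [hP, Category.assoc, e.toMatrix_spec hN, IsSemilinear.map_smul,
        CategoryTheory.Functor.map_id,
        Linear.comp_smul, Linear.smul_comp, Category.id_comp, smul_smul]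
      rfl
    constructor
    · rintro ⟨x, hx⟩ σ
      obtain rfl : DescentSystem.Hom.hom x = g := e.toMatrix_injective hN hx
      ext a b
      refine hN.smul_hom_injective (p σ) ?_
      rw [← h₁, ← h₂, DescentSystem.Hom.comm]
    · intro h
      refine ⟨⟨g, fun σ => e.hom_ext fun a => (e.map (twist σ)).hom_ext' fun b => ?_⟩, rfl⟩
      change (twist σ).map (e.incl b) ≫ _ = (twist σ).map (e.incl b) ≫ _
      rw [h₁, h₂, h]

/-- The product of the `^τ N` is a power of `N`. -/
def powerDecompositionRes [HasFiniteProducts C] [Finite G] (p : ∀ σ : G, (twist σ).obj N ≅ N)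
    (ε : ι ≃ G) : PowerDecomposition ι N (∏ᶜ fun τ : G => (twist τ).obj N) where
  incl a := Pi.lift fun τ : G => if a = ε.symm τ then (p τ).inv else 0
  proj a := Pi.π (fun τ : G => (twist τ).obj N) (ε a) ≫ (p (ε a)).hom
  incl_proj a b := by
    rw [Pi.lift_π_assoc]
    by_cases h : a = b
    · simp [h]
    · simp [h]
  sum_proj_incl := by
    refine Limits.Pi.hom_ext _ _ fun τ => ?_
    obtain ⟨b, rfl⟩ := ε.surjective τ
    simp only [Preadditive.sum_comp, Category.assoc, limit.lift_π, Fan.mk_π_app]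
    rw [Finset.sum_eq_single b]
    · simp
    · intro a _ hab
      simp [hab]
    · simp

end EndDescentSystem

/-! ### Descent systems with a given underlying object -/

section DescentSystems

variable {Γ : Type w} [Group Γ] {C : Type u} [Category.{v} C] [GammaCategory Γ C]

lemma DescentSystem.isFactorSet {L : Type w'} [Field L] [Preadditive C] [Linear L C]
    (X : DescentSystem Γ C) : IsFactorSet X.φ (1 : Γ × Γ → Lˣ) := by
  rintro σ τ _ rfl
  rw [Pi.one_apply, Units.val_one, one_smul, X.cond]

/-- Dividing each `p σ` by `y σ` cancels the factor set. -/
lemma IsFactorSet.exists_descentSystem {L : Type w'} [Field L] [MulSemiringAction Γ L]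
    [Preadditive C] [Linear L C] [IsSemilinear Γ L C] {N : C}
    {p : ∀ σ : Γ, (twist σ).obj N ≅ N} {f : Γ × Γ → Lˣ} (hf : IsFactorSet p f) (y : Γ → Lˣ)
    (hy : ∀ σ τ, σ • y τ / y (σ * τ) * y σ = f (σ, τ)) :
    ∃ X : DescentSystem Γ C, X.obj = N := by
  refine ⟨⟨N, fun σ => ⟨((y σ)⁻¹ : Lˣ).1 • (p σ).hom, (y σ).1 • (p σ).inv, ?_, ?_⟩,
    fun σ τ => ?_⟩, rfl⟩
  · rw [Linear.smul_comp, Linear.comp_smul, smul_smul, Iso.hom_inv_id, Units.inv_mul, one_smul]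
  · rw [Linear.smul_comp, Linear.comp_smul, smul_smul, Iso.inv_hom_id, Units.mul_inv, one_smul]
  · have h : (y (σ * τ))⁻¹ = σ • (y τ)⁻¹ * (y σ)⁻¹ * f (σ, τ) := by
      rw [← hy, smul_inv', div_mul_eq_mul_div, div_eq_mul_inv, ← mul_inv, inv_mul_cancel_left]
    have h' := congrArg Units.val h
    simp only [Units.val_mul] at h'
    dsimp only
    rw [IsSemilinear.map_smul, Linear.smul_comp, Linear.comp_smul, Linear.comp_smul, hf rfl,
      smul_smul, smul_smul, h']
    rfl

/-- Transport of structure; it is needed because a descent datum must have `M` itself as underlying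
object. -/
lemma DescentSystem.exists_iso_of_obj_iso (X : DescentSystem Γ C) {M : C} (e : X.obj ≅ M) :
    ∃ Y : DescentSystem Γ C, Y.obj = M ∧ Nonempty (X ≅ Y) := by
  let Y : DescentSystem Γ C :=
    { obj := M
      φ := fun σ => (twist σ).mapIso e.symm ≪≫ X.φ σ ≪≫ e
      cond := fun σ τ => by
        have nat := (mu (rfl : σ * τ = σ * τ)).hom.naturality e.inv
        simp only [Functor.comp_map] at nat
        simp only [Iso.trans_hom, Functor.mapIso_hom, Iso.symm_hom, Functor.map_comp,
          Category.assoc]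
        rw [← reassoc_of% nat, reassoc_of% (X.cond σ τ), ← Functor.map_comp_assoc _ e.hom]
        simp }
  refine ⟨Y, rfl, ⟨⟨e.hom, fun σ => ?_⟩, ⟨e.inv, fun σ => ?_⟩, DescentSystem.hom_ext ?_,
    DescentSystem.hom_ext ?_⟩⟩
  · simp [Y, ← Functor.map_comp_assoc]
  · simp [Y]
  · exact e.hom_inv_id
  · exact e.inv_hom_id

end DescentSystems

/-! ### Linear functors that are fully faithful after extension of scalars -/

section FullyFaithful

variable (K : Type w) [Field K] (L : Type w') [Field L] [Algebra K L]
    {C : Type u} [Category.{v} C] [Preadditive C] [Linear K C]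
    {D : Type u'} [Category.{v'} D] [Preadditive D] [Linear L D]
    (T : C ⥤ D) [IsLinearAlong (algebraMap K L) T]

include K L

lemma additive_of_isLinearAlong : T.Additive :=
  ⟨fun {_ _} => IsLinearAlong.map_add (algebraMap K L) _ _⟩

variable (hT : ∀ X Y : C, Function.Bijective (baseChangeMap K L T X Y))

include hT

lemma faithful_of_bijective_baseChangeMap : T.Faithful where
  map_injective {X Y} f g h := by
    refine Module.Flat.tensorProduct_mk_injective K (X ⟶ Y) L ((hT X Y).1 ?_)
    simpa using h

/-- The maps `T f` span the one-dimensional space `Hom(T X, T Y)` over `L`, so some `T f` is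
nonzero. -/
lemma exists_map_eq_smul {X Y : C} (e : T.obj X ≅ T.obj Y) (hY : IsScalar L (T.obj Y)) :
    ∃ (f : X ⟶ Y) (c : Lˣ), T.map f = (c : L) • e.hom := by
  obtain ⟨t, ht⟩ := (hT X Y).2 e.hom
  by_contra! h
  have h₀ : ∀ f : X ⟶ Y, T.map f = 0 := by
    intro f
    obtain ⟨c, hc⟩ := hY.exists_smul_hom e (T.map f)
    by_cases hc₀ : c = 0
    · rw [hc, hc₀, zero_smul]
    · exact absurd hc (h f (Units.mk0 c hc₀))
  have h₁ : ∀ t, baseChangeMap K L T X Y t = 0 := fun t => by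
    induction t using TensorProduct.induction_on with
    | zero => exact map_zero _
    | tmul a f => rw [baseChangeMap_tmul, h₀, smul_zero]
    | add x y hx hy => rw [map_add, hx, hy, add_zero]
  refine hY.not_isZero ((IsZero.iff_id_eq_zero _).2 ?_)
  rw [← e.inv_hom_id, ← ht, h₁, comp_zero]

/-- Some `T f` is a unit multiple of `e`, hence invertible, and a faithful functor on a balanced
category reflects isomorphisms. -/
lemma nonempty_iso_of_map_iso [Balanced C] {X Y : C} (e : T.obj X ≅ T.obj Y)
    (hY : IsScalar L (T.obj Y)) : Nonempty (X ≅ Y) := by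
  obtain ⟨f, c, hf⟩ := exists_map_eq_smul K L T hT e hY
  have := faithful_of_bijective_baseChangeMap K L T hT
  have : IsIso (T.map f) := by
    rw [hf]
    exact ⟨((c⁻¹ : Lˣ) : L) • e.inv, by simp [smul_smul], by simp [smul_smul]⟩
  have := isIso_of_reflects_iso f T
  exact ⟨asIso f⟩

/-- Dimension is unchanged by extension of scalars, so `End N` is one-dimensional over `K`. -/
lemma isScalar_of_map {N : C} (hN : IsScalar L (T.obj N)) : IsScalar K N where
  not_isZero h := by
    have := additive_of_isLinearAlong K L T
    exact hN.not_isZero (T.map_isZero h)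
  exists_smul := by
    have hfin : Module.finrank L (T.obj N ⟶ T.obj N) = 1 := by
      refine (finrank_eq_one_iff_of_nonzero' (𝟙 (T.obj N))
        fun h => hN.not_isZero ((IsZero.iff_id_eq_zero _).2 h)).2 fun f => ?_
      obtain ⟨c, hc⟩ := hN.exists_smul f
      exact ⟨c, hc.symm⟩
    have hsmul : ∀ (c : L) (t : L ⊗[K] (N ⟶ N)),
        baseChangeMap K L T N N (c • t) = c • baseChangeMap K L T N N t := fun c t => by
      induction t using TensorProduct.induction_on with
      | zero => simp
      | tmul a f =>
        rw [TensorProduct.smul_tmul', baseChangeMap_tmul, baseChangeMap_tmul, smul_eq_mul, mul_smul]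
      | add x y hx hy => rw [smul_add, map_add, map_add, hx, hy, smul_add]
    let E : L ⊗[K] (N ⟶ N) ≃ₗ[L] (T.obj N ⟶ T.obj N) :=
      LinearEquiv.ofBijective { baseChangeMap K L T N N with map_smul' := hsmul } (hT N N)
    have h₁ : Module.finrank K (N ⟶ N) = 1 := by
      rw [← Module.finrank_baseChange (R := L), E.finrank_eq, hfin]
    intro f
    have h₂ : 𝟙 N ≠ 0 := fun h => hN.not_isZero ((IsZero.iff_id_eq_zero _).2 (by
      have := additive_of_isLinearAlong K L T
      rw [← T.map_id, h, T.map_zero]))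
    obtain ⟨c, hc⟩ := (finrank_eq_one_iff_of_nonzero' (𝟙 N) h₂).1 h₁ f
    exact ⟨c, hc.symm⟩

end FullyFaithful

/-! ### Cochains on the Galois group -/

section Galois

variable {F : Type w} [Field F] {F' : Type w'} [Field F'] [Algebra F F']

/-- The action of the Galois group on the units, as a shortcut for instance search. -/
instance galoisUnitsSMul (K : FiniteGaloisIntermediateField F F') : SMul Gal(K/F) Kˣ :=
  (Units.mulDistribMulActionRight : MulDistribMulAction Gal(K/F) Kˣ).toSMul

/-- The action of a subgroup of the Galois group on the units, as a shortcut for instance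
search. -/
instance subgroupUnitsSMul (K : FiniteGaloisIntermediateField F F') (H : Subgroup Gal(K/F)) :
    SMul H Kˣ :=
  (Units.mulDistribMulActionRight : MulDistribMulAction H Kˣ).toSMul

lemma restrictHom_restrictNormalHom {K' K : FiniteGaloisIntermediateField F F'} (h : K' ≤ K)
    (σ : Gal(F'/F)) : restrictHom h (AlgEquiv.restrictNormalHom K σ) =
      AlgEquiv.restrictNormalHom K' σ := by
  ext x
  exact (restrictHom_apply h _ x).trans ((AlgEquiv.restrictNormalHom_apply
    K.toIntermediateField σ _).trans (AlgEquiv.restrictNormalHom_apply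
    K'.toIntermediateField σ x).symm)

/-- If the inflation of a finite cochain is the coboundary of a continuous cochain, then it is
already a coboundary over a finite extension. -/
lemma exists_finite_coboundary [IsGalois F F'] (K : FiniteGaloisIntermediateField F F')
    (f : Gal(K/F) × Gal(K/F) → Kˣ) (x : Gal(F'/F) → F'ˣ) (hx : IsLocallyConstant x)
    (h : ∀ σ τ, σ • x τ / x (σ * τ) * x σ = Units.map (algebraMap K F' : K →* F')
      (f (AlgEquiv.restrictNormalHom K σ, AlgEquiv.restrictNormalHom K τ))) :
    ∃ (K' : FiniteGaloisIntermediateField F F') (hK : K ≤ K') (y : Gal(K'/F) → K'ˣ),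
      ∀ σ τ : Gal(K'/F), σ • y τ / y (σ * τ) * y σ =
        Units.map ((IntermediateField.inclusion hK).toRingHom : K →* K')
          (f (restrictHom hK σ, restrictHom hK τ)) := by
  -- `x` is invariant under translation by a neighbourhood of `1`
  have hU : {τ : Gal(F'/F) | x τ = x 1} ∩ K.toIntermediateField.fixingSubgroup ∈ nhds 1 :=
    ((hx.isOpen_fiber (x 1)).inter
      (IntermediateField.fixingSubgroup_isOpen K.toIntermediateField)).mem_nhds ⟨rfl, one_mem _⟩
  obtain ⟨E, hE₁, hE₂, hE⟩ := (krullTopology_mem_nhds_one_iff_of_normal F F' _).1 hU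
  -- Compare the coboundary relation at `(σ, τ)` and `(σ, 1)`: the right-hand sides agree because
  -- `τ` is trivial on `K`, and `x τ = x 1`.
  have hmul : ∀ σ, ∀ τ ∈ E.fixingSubgroup, x (σ * τ) = x σ := by
    intro σ τ hτ
    obtain ⟨h₁, h₂⟩ := hE hτ
    rw [← IntermediateField.restrictNormalHom_ker] at h₂
    have h₃ := h σ τ
    have h₄ := h σ 1
    rw [show x τ = x 1 from h₁, show AlgEquiv.restrictNormalHom K τ = 1 from h₂, ← map_one
      (AlgEquiv.restrictNormalHom K : Gal(F'/F) →* Gal(K/F)), ← h₄, mul_one, mul_left_inj,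
      div_right_inj] at h₃
    exact h₃
  -- A locally constant function on the compact group `Gal(F'/F)` takes finitely many values.
  have hfin : (Set.range fun σ => (x σ : F')).Finite := by
    have := (hx.comp fun a : F'ˣ => (a : F')).range_finite
    exact this
  have := hfin.to_subtype
  let E' : FiniteGaloisIntermediateField F F' := { E with
    finiteDimensional := hE₁
    isGalois := { __ := (inferInstance : Algebra.IsSeparable F E), __ := hE₂ } }
  -- Containing `E'` lets `x` factor through `Gal(K'/F)`; adjoining its values makes it take values
  -- in `K'`.
  let K' := (K ⊔ E') ⊔ FiniteGaloisIntermediateField.adjoin F (Set.range fun σ => (x σ : F'))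
  have hK : K ≤ K' := le_sup_left.trans le_sup_left
  have hE' : E' ≤ K' := le_sup_right.trans le_sup_left
  have hxK : ∀ σ, (x σ : F') ∈ K'.toIntermediateField := fun σ =>
    (le_sup_right : FiniteGaloisIntermediateField.adjoin F _ ≤ K')
      (FiniteGaloisIntermediateField.subset_adjoin F _ ⟨σ, rfl⟩)
  have hres : Function.Surjective (AlgEquiv.restrictNormalHom K' : Gal(F'/F) →* Gal(K'/F)) :=
    AlgEquiv.restrictNormalHom_surjective F'
  choose lift hlift using hres
  have hx_lift : ∀ σ, x (lift (AlgEquiv.restrictNormalHom K' σ)) = x σ := by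
    intro σ
    have h₁ : σ⁻¹ * lift (AlgEquiv.restrictNormalHom K' σ) ∈
        K'.toIntermediateField.fixingSubgroup := by
      rw [← IntermediateField.restrictNormalHom_ker, MonoidHom.mem_ker, map_mul, map_inv]
      exact inv_mul_eq_one.2 (hlift _).symm
    have h₂ := hmul σ _ (IntermediateField.fixingSubgroup_antitone hE' h₁)
    rwa [mul_inv_cancel_left] at h₂
  let y : Gal(K'/F) → K'ˣ := fun τ => Units.mk0 ⟨x (lift τ), hxK _⟩ fun h =>
    Units.ne_zero _ (congrArg Subtype.val h)
  have hy : ∀ σ, Units.map (algebraMap K' F' : K' →* F') (y (AlgEquiv.restrictNormalHom K' σ)) =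
      x σ := fun σ => Units.ext (by
    have := congrArg Units.val (hx_lift σ)
    exact this)
  refine ⟨K', hK, y, fun σ τ => ?_⟩
  obtain ⟨σ, rfl⟩ := AlgEquiv.restrictNormalHom_surjective F' σ
  obtain ⟨τ, rfl⟩ := AlgEquiv.restrictNormalHom_surjective F' τ
  have hinj : Function.Injective (Units.map (algebraMap K' F' : K' →* F')) :=
    Units.map_injective (algebraMap K' F').injective
  apply hinj
  have hsmul : ∀ a : K'ˣ, Units.map (algebraMap K' F' : K' →* F')
      (AlgEquiv.restrictNormalHom K' σ • a) = σ • Units.map (algebraMap K' F' : K' →* F') a :=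
    fun a => Units.ext (AlgEquiv.restrictNormalHom_apply K'.toIntermediateField σ a)
  rw [map_mul, map_div, hsmul, ← map_mul, hy, hy, hy, h, restrictHom_restrictNormalHom,
    restrictHom_restrictNormalHom]
  rfl

end Galois

/-! ### The finite Borel–Tits class as the class of a factor set. -/

section FiniteClass

variable {G : Type w} [Group G] [TopologicalSpace G] [DiscreteTopology G] [Finite G]
  {L : Type w'} [Field L] [MulSemiringAction G L] {C : Type u} [Category.{v} C]

omit [Finite G] in
lemma exists_cocycle_isFactorSet [Preadditive C] [Linear L C] [GammaCategory G C]
    [IsSemilinear G L C] {N : C} (hN : IsScalar L N) (p : ∀ σ : G, (twist σ).obj N ≅ N) :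
    ∃ f : contCocycles₂ G Lˣ, IsFactorSet p f.1 := by
  obtain ⟨f, hf⟩ := exists_isFactorSet hN p
  exact ⟨⟨f, hf.isMulCocycle₂ hN, IsLocallyConstant.of_discrete f⟩, hf⟩

/-- The Borel--Tits class of a self-conjugate object with scalar endomorphisms is the class of its
factor set. -/
theorem isFiniteBorelTitsClass_iff [FaithfulSMul G L] [Abelian C] [Linear L C] [GammaCategory G C]
    [IsAdditive G C] [IsSemilinear G L C] {N : C} (hN : IsScalar L N)
    {p : ∀ σ : G, (twist σ).obj N ≅ N} (f : contCocycles₂ G Lˣ) (hf : IsFactorSet p f.1)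
    (b : H2Units G L) : IsFiniteBorelTitsClass G L N b ↔ b = H2.mk f := by
  have h : IsBrauerClass G L (End (DescentSystem.res G N)) (H2.mk f)⁻¹ :=
    isBrauerClass_end (R := DescentSystem.res G N) Nat.card_pos hN
      (powerDecompositionRes p (Finite.equivFin G).symm) f hf
  constructor
  · intro hb
    have hb' : IsBrauerClass G L (End (DescentSystem.res G N)) b⁻¹ := hb
    exact inv_injective (hb'.unique h)
  · rintro rfl
    exact h

end FiniteClass

/-! ### Forms of `M`, the field of rationality and inflated classes. -/

section Data

variable {F : Type w} [Field F] {F' : Type w'} [Field F'] [Algebra F F'] [IsGalois F F']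
  {C : Type u} [Category.{v} C] [Abelian C] [Linear F' C] [GammaCategory Gal(F'/F) C]
  [IsAdditive Gal(F'/F) C] [IsSemilinear Gal(F'/F) F' C]
  {D : Datum.{w, w', u, v, u', v'} F F' C} {M : C}

namespace Datum

variable {K : FiniteGaloisIntermediateField F F'} {N : D.cat K}

omit [IsGalois F F'] in
lemma IsForm.isScalar (hN : D.IsForm M K N) (hM : IsScalar F' M) : IsScalar K N := by
  obtain ⟨e⟩ := hN
  exact isScalar_of_map K F' (D.top K) (D.bijective_baseChangeMap K) (hM.of_iso e)

omit [IsGalois F F'] in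
lemma IsForm.bc (hN : D.IsForm M K N) {K' : FiniteGaloisIntermediateField F F'} (h : K ≤ K') :
    D.IsForm M K' ((D.bc h).obj N) := by
  obtain ⟨e⟩ := hN
  exact ⟨(D.γTop h).app N ≪≫ e⟩

omit [IsGalois F F'] in
/-- Two forms over the same field are isomorphic. -/
lemma IsForm.nonempty_iso (hN : D.IsForm M K N) {N' : D.cat K} (hN' : D.IsForm M K N')
    (hM : IsScalar F' M) : Nonempty (N ≅ N') := by
  obtain ⟨e⟩ := hN
  obtain ⟨e'⟩ := hN'
  exact nonempty_iso_of_map_iso K F' (D.top K) (D.bijective_baseChangeMap K) (e ≪≫ e'.symm)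
    (hM.of_iso e')

omit [IsGalois F F'] in
/-- A conjugate of a form is a form of the conjugate. -/
lemma IsForm.twist (hN : D.IsForm M K N) (σ : Gal(F'/F)) :
    D.IsForm ((GammaCategory.twist σ).obj M) K
      ((GammaCategory.twist (AlgEquiv.restrictNormalHom K σ : Gal(K/F))).obj N) := by
  obtain ⟨e⟩ := hN
  exact ⟨(((D.twistTop K).α σ).app N).symm ≪≫ (GammaCategory.twist σ).mapIso e⟩

-- If `σ` is trivial on `K`, then `^σ M` has the form `^1 N ≅ N`, just as `M` has.
omit [IsGalois F F'] in
lemma IsForm.fixingSubgroup_le (hN : D.IsForm M K N) :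
    K.toIntermediateField.fixingSubgroup ≤ stabilizer Gal(F'/F) M := by
  intro σ hσ
  rw [← IntermediateField.restrictNormalHom_ker] at hσ
  obtain ⟨e⟩ := hN
  obtain ⟨e'⟩ := IsForm.twist ⟨e⟩ σ
  rw [show AlgEquiv.restrictNormalHom K σ = 1 from hσ] at e'
  exact ⟨e'.symm ≪≫ (D.top K).mapIso (unit.app N) ≪≫ e⟩

/-- `Γ_M` contains the open subgroup fixing `K`, so it is open, hence closed, and the infinite
Galois correspondence applies. -/
lemma IsForm.fixingSubgroup_rationalityField (hN : D.IsForm M K N) :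
    (rationalityField F F' M).fixingSubgroup = stabilizer Gal(F'/F) M := by
  have hopen : IsOpen (stabilizer Gal(F'/F) M : Set Gal(F'/F)) :=
    Subgroup.isOpen_mono hN.fixingSubgroup_le
      (IntermediateField.fixingSubgroup_isOpen K.toIntermediateField)
  exact InfiniteGalois.fixingSubgroup_fixedField
    ⟨stabilizer Gal(F'/F) M, Subgroup.isClosed_of_isOpen _ hopen⟩

lemma IsForm.rationalityField_le (hN : D.IsForm M K N) :
    rationalityField F F' M ≤ K.toIntermediateField := by
  rw [← InfiniteGalois.fixedField_fixingSubgroup K.toIntermediateField]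
  exact IntermediateField.fixedField_antitone hN.fixingSubgroup_le

/-- Any lift of `τ` works: since `F(M) ⊆ K`, it fixes `F(M)` and so lies in `Γ_M`. -/
lemma IsForm.exists_mem_stabilizer (hN : D.IsForm M K N) {τ : Gal(K/F)}
    (hτ : τ ∈ relGal F F' K M) :
    ∃ σ ∈ stabilizer Gal(F'/F) M, AlgEquiv.restrictNormalHom K σ = τ := by
  obtain ⟨σ, rfl⟩ := AlgEquiv.restrictNormalHom_surjective F' τ
  refine ⟨σ, ?_, rfl⟩
  rw [← hN.fixingSubgroup_rationalityField, IntermediateField.mem_fixingSubgroup_iff]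
  intro x hx
  have h := (IntermediateField.mem_fixingSubgroup_iff _ _).1 hτ ⟨x, hN.rationalityField_le hx⟩ hx
  rw [← AlgEquiv.restrictNormalHom_apply K.toIntermediateField σ ⟨x, hN.rationalityField_le hx⟩]
  exact congrArg Subtype.val h

/-- Lift `τ` to `σ ∈ Γ_M`. Then `^τ N` is a form of `^σ M ≅ M`, and forms over one field are
isomorphic. -/
lemma IsForm.nonempty_twist_iso (hN : D.IsForm M K N) (hM : IsScalar F' M) :
    Nonempty (∀ τ : relGal F F' K M, (GammaCategory.twist τ).obj N ≅ N) := by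
  refine Classical.nonempty_pi.2 fun τ => ?_
  obtain ⟨σ, ⟨e⟩, hσ⟩ := hN.exists_mem_stabilizer τ.2
  have h := hN.twist σ
  rw [hσ] at h
  obtain ⟨e'⟩ := h
  exact IsForm.nonempty_iso ⟨e' ≪≫ e⟩ hN hM

omit [IsGalois F F'] [Abelian C] [Linear F' C] [IsAdditive Gal(F'/F) C]
  [IsSemilinear Gal(F'/F) F' C] in
lemma restrictHom_mem_relGal {K K' : FiniteGaloisIntermediateField F F'} (h : K ≤ K')
    (σ : relGal F F' K' M) :
    ((restrictHom h).comp (relGal F F' K' M).subtype) σ ∈ relGal F F' K M := by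
  refine (IntermediateField.mem_fixingSubgroup_iff _ _).2 fun x hx => Subtype.ext ?_
  have := (IntermediateField.mem_fixingSubgroup_iff _ _).1 σ.2 (IntermediateField.inclusion h x) hx
  exact (restrictHom_apply h _ x).trans (congrArg Subtype.val this)

omit [IsGalois F F'] in
lemma isBorelTitsClassOf_iff (hN : D.IsForm M K N) (hM : IsScalar F' M)
    {p : ∀ τ : relGal F F' K M, (GammaCategory.twist τ).obj N ≅ N}
    (f : contCocycles₂ (relGal F F' K M) Kˣ) (hf : IsFactorSet p f.1)
    (c : H2Units (stabilizer Gal(F'/F) M) F') :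
    D.IsBorelTitsClassOf M K N c ↔ c = inflation F F' K M (H2.mk f) := by
  constructor
  · rintro ⟨b, hb, rfl⟩
    rw [(isFiniteBorelTitsClass_iff (hN.isScalar hM) f hf b).1 hb]
  · rintro rfl
    exact ⟨_, (isFiniteBorelTitsClass_iff (hN.isScalar hM) f hf _).2 rfl, rfl⟩

omit [IsGalois F F'] in
/-- The inflations of the factor sets of two forms are cohomologous. -/
lemma inflation_eq_of_isForm (hM : IsScalar F' M) (hN : D.IsForm M K N)
    {p : ∀ τ : relGal F F' K M, (GammaCategory.twist τ).obj N ≅ N}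
    (f : contCocycles₂ (relGal F F' K M) Kˣ) (hf : IsFactorSet p f.1)
    {K' : FiniteGaloisIntermediateField F F'} {N' : D.cat K'} (hN' : D.IsForm M K' N')
    {p' : ∀ τ : relGal F F' K' M, (GammaCategory.twist τ).obj N' ≅ N'}
    (f' : contCocycles₂ (relGal F F' K' M) K'ˣ) (hf' : IsFactorSet p' f'.1) :
    inflation F F' K M (H2.mk f) = inflation F F' K' M (H2.mk f') := by
  have h : K ≤ K ⊔ K' := le_sup_left
  have h' : K' ≤ K ⊔ K' := le_sup_right
  set E := K ⊔ K'
  -- Over the compositum both become forms of `M` over one field, so their factor sets there differ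
  -- by a coboundary, which is then inflated.
  obtain ⟨e⟩ := (hN.bc h).nonempty_iso (hN'.bc h') hM
  have q := ((D.twistBc h).restrict (relGal F F' E M) (relGal F F' K M)
    (restrictHom_mem_relGal h)).isFactorSet_mapTwistIso _ (D.linear_bc h) hf
  have q' := ((D.twistBc h').restrict (relGal F F' E M) (relGal F F' K' M)
    (restrictHom_mem_relGal h')).isFactorSet_mapTwistIso _ (D.linear_bc h') hf'
  obtain ⟨x, hx⟩ := q'.exists_coboundary ((hN'.bc h').isScalar hM) e q
  refine QuotientGroup.eq.2 (Subgroup.mem_subgroupOf.2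
    ⟨fun σ => Units.map (algebraMap E F' : E →* F') (x (stabilizerToRelGal F F' E M σ)),
    ((IsLocallyConstant.of_discrete x).comp_continuous
      (continuous_stabilizerToRelGal F F' E M)).comp _, fun σ τ => ?_⟩)
  have hres : ∀ {K₁ : FiniteGaloisIntermediateField F F'} (h₁ : K₁ ≤ E)
      (σ : stabilizer Gal(F'/F) M), ((restrictHom h₁).comp (relGal F F' E M).subtype).codRestrict
        (relGal F F' K₁ M) (restrictHom_mem_relGal h₁) (stabilizerToRelGal F F' E M σ) =
      stabilizerToRelGal F F' K₁ M σ := fun h₁ σ =>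
    Subtype.ext (restrictHom_restrictNormalHom h₁ (σ : Gal(F'/F)))
  have key := congrArg (Units.map (algebraMap E F' : E →* F'))
    (hx (stabilizerToRelGal F F' E M σ) (stabilizerToRelGal F F' E M τ))
  have hsmul : ∀ a : Eˣ, Units.map (algebraMap E F' : E →* F')
      (stabilizerToRelGal F F' E M σ • a) = σ • Units.map (algebraMap E F' : E →* F') a :=
    fun a => Units.ext (AlgEquiv.restrictNormalHom_apply E.toIntermediateField (σ : Gal(F'/F)) a)
  rw [map_mul, map_div, map_div, hsmul, ← map_mul, hres, hres, hres, hres] at key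
  refine key.trans ?_
  rw [div_eq_mul_inv, mul_comm]
  rfl

end Datum

end Data

end BorelTits

/-! ### The class of `M` and the descent criterion. -/

theorem mainTheorem2 {F : Type w} [Field F] {F' : Type w'} [Field F'] [Algebra F F']
    [IsGalois F F'] {C : Type u} [Category.{v} C] [Abelian C] [Linear F' C]
    [BorelTits.GammaCategory Gal(F'/F) C] [BorelTits.IsAdditive Gal(F'/F) C]
    [BorelTits.IsSemilinear Gal(F'/F) F' C] (D : BorelTits.Datum.{w, w', u, v, u', v'} F F' C)
    (M : C) (hM₀ : ¬ IsZero M) (hM : ∀ f : M ⟶ M, ∃ c : F', f = c • 𝟙 M) :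
    ∃ β : BorelTits.H2Units (BorelTits.stabilizer Gal(F'/F) M) F',
      (∀ (K : FiniteGaloisIntermediateField F F') (N : D.cat K), D.IsForm M K N →
        ∀ c : BorelTits.H2Units (BorelTits.stabilizer Gal(F'/F) M) F',
          D.IsBorelTitsClassOf M K N c ↔ c = β) ∧
      (D.AdmitsDescentDatum M ↔ BorelTits.IsSelfConjugate Gal(F'/F) M ∧ β = 1) := by
  have hM' : BorelTits.IsScalar F' M := ⟨hM₀, hM⟩
  obtain ⟨K, N, hN⟩ := D.exists_form M
  replace hN : D.IsForm M K N := hN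
  obtain ⟨p⟩ := hN.nonempty_twist_iso hM'
  obtain ⟨f, hf⟩ := BorelTits.exists_cocycle_isFactorSet (hN.isScalar hM') p
  refine ⟨BorelTits.inflation F F' K M (BorelTits.H2.mk f), fun K' N' hN' c => ?_, ?_, ?_⟩
  · obtain ⟨p'⟩ := hN'.nonempty_twist_iso hM'
    obtain ⟨f', hf'⟩ := BorelTits.exists_cocycle_isFactorSet (hN'.isScalar hM') p'
    rw [BorelTits.Datum.isBorelTitsClassOf_iff hN' hM' f' hf',
      BorelTits.Datum.inflation_eq_of_isForm hM' hN f hf hN' f' hf']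
  · rintro ⟨X, hX, rfl⟩
    refine ⟨fun σ => ⟨X.φ σ⟩, ?_⟩
    -- The form `Y.obj` may differ from `N`, but it computes the same class, and its own descent
    -- isomorphisms have factor set `1`.
    obtain ⟨Y, ⟨e⟩⟩ := D.essSurj K X hX
    have hY : D.IsForm X.obj K Y.obj := ⟨e.hom.hom, e.inv.hom,
      congrArg BorelTits.DescentSystem.Hom.hom e.hom_inv_id,
      congrArg BorelTits.DescentSystem.Hom.hom e.inv_hom_id⟩
    have h₁ : BorelTits.IsFactorSet (L := K)
        (fun τ : BorelTits.relGal F F' K X.obj => Y.φ τ) 1 := fun _ _ _ h =>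
      Y.isFactorSet (congrArg Subtype.val h)
    rw [BorelTits.Datum.inflation_eq_of_isForm hM' hN f hf hY 1 h₁]
    exact (BorelTits.inflation F F' K X.obj).map_one
  · rintro ⟨hself, hβ⟩
    -- Self-conjugacy makes `Γ_{K/F(M)}` all of `Gal(K/F)`, so `p` and `f` are defined on the whole
    -- group.
    have hmem : ∀ τ : Gal(K/F), τ ∈ BorelTits.relGal F F' K M := by
      intro τ
      obtain ⟨σ, rfl⟩ := AlgEquiv.restrictNormalHom_surjective F' τ
      exact (BorelTits.stabilizerToRelGal F F' K M ⟨σ, hself σ⟩).2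
    obtain ⟨x, hx, hxf⟩ := Subgroup.mem_subgroupOf.1 ((QuotientGroup.eq_one_iff _).1 hβ)
    obtain ⟨E, hE, y, hy⟩ := BorelTits.exists_finite_coboundary K
      (fun s => f.1 (⟨s.1, hmem s.1⟩, ⟨s.2, hmem s.2⟩)) (fun σ => x ⟨σ, hself σ⟩)
      (hx.comp_continuous (continuous_id.subtype_mk fun σ =>
        (hself σ : σ ∈ BorelTits.stabilizer Gal(F'/F) M))) fun σ τ =>
        hxf ⟨σ, hself σ⟩ ⟨τ, hself τ⟩
    have hfac : BorelTits.IsFactorSet (fun τ : Gal(K/F) => p ⟨τ, hmem τ⟩)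
        (fun s => f.1 (⟨s.1, hmem s.1⟩, ⟨s.2, hmem s.2⟩)) := fun σ τ ρ h =>
      hf (σ := ⟨σ, hmem σ⟩) (τ := ⟨τ, hmem τ⟩) (ρ := ⟨ρ, hmem ρ⟩) (Subtype.ext h)
    -- The cochain `y` has values in `E`, so the rescaling takes place on `E ⊗_K N` rather than on
    -- `N`.
    obtain ⟨Y, hY⟩ := ((D.twistBc hE).isFactorSet_mapTwistIso _
      (D.linear_bc hE) hfac).exists_descentSystem y hy
    obtain ⟨e⟩ := hN.bc hE
    obtain ⟨X, hX, hiso⟩ := ((D.twistTop E).mapDS.obj Y).exists_iso_of_obj_iso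
      ((D.top E).mapIso (eqToIso hY) ≪≫ e)
    exact ⟨X, D.strict hiso (D.mapDS_mem E Y), hX⟩
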